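/- Let $R=\bigoplus_{n\ge 0}R_n$ be a standard graded commutative Noetherian ring, i.e. $R_0$ is Noetherian and $R$ is generated as an $R_0$-algebra by finitely many elements of $R_1$, and let $R_+=\bigoplus_{n\ge 1}R_n$. For ideals $I,J$ of $R$ and a $\mathbb{Z}$-graded $R$-module $M$ let $\Gamma_{I,J}(M)=\{x\in M : I^kx\subseteq Jx \text{ for all } k\gg 0\}$, which is a graded submodule of $M$, and let $H^i_{I,J}$ be the $i$-th right derived functor of $\Gamma_{I,J}$ on the category of $\mathbb{Z}$-graded $R$-modules and homogeneous homomorphisms of degree $0$; write $H^i_{I,J}(M)_n$ for the component of degree $n$ of the graded module $H^i_{I,J}(M)$, which is an $R_0$-module. Assume that $R_0$ is local with maximal ideal $\mathfrak m_0$. Let $i\ge 0$ be an integer, let $\mathfrak b_0$ be an ideal of $R_0$ and put $\mathfrak b=\mathfrak b_0R+R_+$. Suppose that for every finitely generated graded $R$-module $M$ one has $$\bigcap_{k=0}^\infty \mathfrak m_0^k\,H^i_{\mathfrak b,\mathfrak m_0R}(M)_n=0\quad\text{for all } n\gg 0 .$$ Then for every finitely generated graded $R$-module $M$ one has $H^i_{\mathfrak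 b,\mathfrak m_0R}(M)_n=0$ for all $n\gg 0$. -/

import Mathlib

open CategoryTheory CategoryTheory.Limits

universe u

noncomputable section

/-- If `A n` are subgroups of `M` and `p n` behaves as the projection onto `A n`, then `M` is the
internal direct sum of the `A n`. -/
theorem directSum_isInternal_of_proj {M : Type*} [AddCommGroup M] (A : ℤ → AddSubgroup M)
    (p : ℤ → M →+ M) (hmem : ∀ n x, p n x ∈ A n) (hsame : ∀ n x, x ∈ A n → p n x = x)
    (hne : ∀ m n x, x ∈ A m → m ≠ n → p n x = 0)
    (hsum : ∀ x, ∃ s : Finset ℤ, x = ∑ n ∈ s, p n x) : DirectSum.IsInternal A := by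
  classical
  constructor
  · intro d e hde
    have key : ∀ (n : ℤ) (d : DirectSum ℤ fun n => A n),
        p n (DirectSum.coeAddMonoidHom A d) = d n := by
      intro n d
      induction d using DirectSum.induction_on with
      | zero => simp
      | of m x =>
        rw [DirectSum.coeAddMonoidHom_of]
        by_cases h : m = n
        · subst h
          rw [hsame _ _ x.2, DirectSum.of_eq_same]
        · rw [hne m n _ x.2 h, DirectSum.of_eq_of_ne _ _ _ (Ne.symm h)]
          rfl
      | add x y hx hy =>
        rw [map_add, map_add, hx, hy]
        rfl
    refine DFinsupp.ext fun n => Subtype.ext ?_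
    rw [← key n d, ← key n e, hde]
  · intro x
    obtain ⟨s, hs⟩ := hsum x
    refine ⟨∑ n ∈ s, DirectSum.of (fun n => A n) n ⟨p n x, hmem n x⟩, ?_⟩
    rw [map_sum]
    simp only [DirectSum.coeAddMonoidHom_of]
    exact hs.symm

/-- A `ℤ`-graded module over the `ℕ`-graded ring `R = ⨁ 𝒜 n`. -/
structure GrMod {R : Type u} [CommRing R] (𝒜 : ℕ → AddSubgroup R) where
  /-- the underlying module -/
  carrier : Type u
  [isAddCommGroup : AddCommGroup carrier]
  [isModule : Module R carrier]
  /-- the homogeneous components -/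
  deg : ℤ → AddSubgroup carrier
  isInternal : DirectSum.IsInternal deg
  smul_mem : ∀ {i : ℕ} {n : ℤ} {r : R} {x : carrier},
    r ∈ 𝒜 i → x ∈ deg n → r • x ∈ deg ((i : ℤ) + n)

namespace GrMod

variable {R : Type u} [CommRing R] {𝒜 : ℕ → AddSubgroup R}

attribute [instance] isAddCommGroup isModule

instance : CoeSort (GrMod 𝒜) (Type u) := ⟨carrier⟩

/-- The projection of a graded module onto its component of degree `n`. -/
def proj (M : GrMod 𝒜) (n : ℤ) : M →+ M :=
  letI := M.isInternal.chooseDecomposition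
  ((M.deg n).subtype.comp (DFinsupp.evalAddMonoidHom (β := fun n => M.deg n) n)).comp
    (DirectSum.decomposeAddEquiv M.deg).toAddMonoidHom

theorem proj_mem (M : GrMod 𝒜) (n : ℤ) (x : M) : M.proj n x ∈ M.deg n := by
  let := M.isInternal.chooseDecomposition
  exact (DirectSum.decompose M.deg x n).2

theorem proj_same {M : GrMod 𝒜} {n : ℤ} {x : M} (h : x ∈ M.deg n) : M.proj n x = x := by
  let := M.isInternal.chooseDecomposition
  exact DirectSum.decompose_of_mem_same M.deg h

theorem proj_ne {M : GrMod 𝒜} {m n : ℤ} {x : M} (h : x ∈ M.deg m) (hmn : m ≠ n) :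
    M.proj n x = 0 := by
  let := M.isInternal.chooseDecomposition
  exact DirectSum.decompose_of_mem_ne M.deg h hmn

theorem exists_sum_proj (M : GrMod 𝒜) (x : M) :
    ∃ s : Finset ℤ, x = ∑ n ∈ s, M.proj n x ∧ ∀ n, n ∉ s → M.proj n x = 0 := by
  classical
  let := M.isInternal.chooseDecomposition
  refine ⟨(DirectSum.decompose M.deg x).support,
    (DirectSum.sum_support_decompose M.deg x).symm, fun n hn => ?_⟩
  have h : DirectSum.decompose M.deg x n = 0 := by simpa using hn
  change ((DirectSum.decompose M.deg x n : M.deg n) : M) = 0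
  rw [h]
  rfl

/-- Homogeneous homomorphisms (of degree `0`) of graded modules. -/
@[ext]
structure Hom (M N : GrMod 𝒜) where
  /-- the underlying linear map -/
  lin : M →ₗ[R] N
  map_mem : ∀ (n : ℤ) (x : M), x ∈ M.deg n → lin x ∈ N.deg n

/-- The category of graded modules and homogeneous homomorphisms. -/
instance : Category (GrMod 𝒜) where
  Hom M N := Hom M N
  id M := ⟨LinearMap.id, fun _ _ h => h⟩
  comp f g := ⟨g.lin.comp f.lin, fun n x h => g.map_mem n _ (f.map_mem n x h)⟩

/-- The linear map underlying a morphism. -/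
def lin {M N : GrMod 𝒜} (f : M ⟶ N) : M →ₗ[R] N := Hom.lin f

theorem lin_mem {M N : GrMod 𝒜} (f : M ⟶ N) {n : ℤ} {x : M} (h : x ∈ M.deg n) :
    lin f x ∈ N.deg n := Hom.map_mem f n x h

/-- Constructor for morphisms. -/
def homMk {M N : GrMod 𝒜} (f : M →ₗ[R] N)
    (h : ∀ (n : ℤ) (x : M), x ∈ M.deg n → f x ∈ N.deg n) : M ⟶ N := Hom.mk f h

@[simp] theorem lin_homMk {M N : GrMod 𝒜} (f : M →ₗ[R] N) (h) :
    lin (homMk f h : M ⟶ N) = f := rfl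

@[simp] theorem lin_id (M : GrMod 𝒜) : lin (𝟙 M) = LinearMap.id := rfl

@[simp] theorem lin_comp {M N P : GrMod 𝒜} (f : M ⟶ N) (g : N ⟶ P) :
    lin (f ≫ g) = (lin g).comp (lin f) := rfl

theorem lin_injective {M N : GrMod 𝒜} :
    Function.Injective (lin : (M ⟶ N) → (M →ₗ[R] N)) :=
  fun _ _ h => Hom.ext h

theorem hom_ext {M N : GrMod 𝒜} {f g : M ⟶ N} (h : ∀ x, lin f x = lin g x) : f = g :=
  lin_injective (LinearMap.ext h)

theorem lin_proj {M N : GrMod 𝒜} (f : M ⟶ N) (n : ℤ) (x : M) :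
    lin f (M.proj n x) = N.proj n (lin f x) := by
  obtain ⟨s, hs, h0⟩ := M.exists_sum_proj x
  conv_rhs => rw [hs]
  rw [map_sum, map_sum]
  by_cases hn : n ∈ s
  · rw [Finset.sum_eq_single_of_mem n hn, proj_same (lin_mem f (M.proj_mem n x))]
    intro m _ hmn
    exact proj_ne (lin_mem f (M.proj_mem m x)) hmn
  · rw [h0 n hn, map_zero, Finset.sum_eq_zero]
    intro m hm
    exact proj_ne (lin_mem f (M.proj_mem m x)) (by rintro rfl; exact hn hm)

instance (M N : GrMod 𝒜) : Zero (M ⟶ N) := ⟨homMk 0 fun n _ _ => (N.deg n).zero_mem⟩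

instance (M N : GrMod 𝒜) : Add (M ⟶ N) :=
  ⟨fun f g => homMk (lin f + lin g) fun n _ h =>
    (N.deg n).add_mem (lin_mem f h) (lin_mem g h)⟩

instance (M N : GrMod 𝒜) : Neg (M ⟶ N) :=
  ⟨fun f => homMk (-lin f) fun n _ h => (N.deg n).neg_mem (lin_mem f h)⟩

instance (M N : GrMod 𝒜) : Sub (M ⟶ N) :=
  ⟨fun f g => homMk (lin f - lin g) fun n _ h =>
    (N.deg n).sub_mem (lin_mem f h) (lin_mem g h)⟩

instance (M N : GrMod 𝒜) : SMul ℕ (M ⟶ N) :=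
  ⟨fun k f => homMk (k • lin f) fun n _ h => (N.deg n).nsmul_mem (lin_mem f h) k⟩

instance (M N : GrMod 𝒜) : SMul ℤ (M ⟶ N) :=
  ⟨fun k f => homMk (k • lin f) fun n _ h => (N.deg n).zsmul_mem (lin_mem f h) k⟩

instance (M N : GrMod 𝒜) : AddCommGroup (M ⟶ N) :=
  Function.Injective.addCommGroup lin lin_injective rfl (fun _ _ => rfl) (fun _ => rfl)
    (fun _ _ => rfl) (fun _ _ => rfl) (fun _ _ => rfl)

@[simp] theorem lin_zero {M N : GrMod 𝒜} : lin (0 : M ⟶ N) = 0 := rfl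

@[simp] theorem lin_add {M N : GrMod 𝒜} (f g : M ⟶ N) : lin (f + g) = lin f + lin g := rfl

instance : Preadditive (GrMod 𝒜) where
  add_comp _ _ _ f f' g := hom_ext fun x => by simp
  comp_add _ _ _ _ _ _ := rfl

/-- A submodule is homogeneous if it contains the homogeneous components of its elements. -/
def IsHomogeneous {M : GrMod 𝒜} (p : Submodule R M) : Prop :=
  ∀ x ∈ p, ∀ n, M.proj n x ∈ p

/-- A homogeneous submodule as a graded module. -/
def sub {M : GrMod 𝒜} (p : Submodule R M) (hp : IsHomogeneous p) : GrMod 𝒜 where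
  carrier := p
  deg n := (M.deg n).comap p.subtype.toAddMonoidHom
  isInternal := by
    refine directSum_isInternal_of_proj _
      (fun n => ((M.proj n).comp p.subtype.toAddMonoidHom).codRestrict p.toAddSubgroup
        fun x => hp x x.2 n) ?_ ?_ ?_ ?_
    · exact fun n x => M.proj_mem n x
    · exact fun n x h => Subtype.ext (proj_same h)
    · exact fun m n x h hmn => Subtype.ext (proj_ne h hmn)
    · intro x
      obtain ⟨s, hs, -⟩ := M.exists_sum_proj (x : M)
      refine ⟨s, Subtype.ext ?_⟩
      conv_lhs => rw [hs]
      exact (map_sum p.subtype (fun n => (⟨M.proj n x, hp x x.2 n⟩ : p)) s).symm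
  smul_mem hr hx := M.smul_mem hr hx

/-- The inclusion of a homogeneous submodule. -/
def subι {M : GrMod 𝒜} (p : Submodule R M) (hp : IsHomogeneous p) : sub p hp ⟶ M :=
  homMk (N := M) (M := sub p hp) p.subtype fun _ _ h => h

/-- The quotient of a graded module by a homogeneous submodule. -/
def quot {M : GrMod 𝒜} (p : Submodule R M) (hp : IsHomogeneous p) : GrMod 𝒜 where
  carrier := M ⧸ p
  deg n := (M.deg n).map p.mkQ.toAddMonoidHom
  isInternal := by
    refine directSum_isInternal_of_proj _
      (fun n => QuotientAddGroup.map p.toAddSubgroup p.toAddSubgroup (M.proj n)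
        fun x hx => hp x hx n) ?_ ?_ ?_ ?_
    · intro n x
      obtain ⟨x, rfl⟩ := p.mkQ_surjective x
      exact ⟨M.proj n x, M.proj_mem n x, rfl⟩
    · rintro n _ ⟨x, hx, rfl⟩
      exact congrArg p.mkQ (proj_same hx)
    · rintro m n _ ⟨x, hx, rfl⟩ hmn
      exact (congrArg p.mkQ (proj_ne hx hmn)).trans (map_zero _)
    · intro x
      obtain ⟨x, rfl⟩ := p.mkQ_surjective x
      obtain ⟨s, hs, -⟩ := M.exists_sum_proj x
      refine ⟨s, ?_⟩
      conv_lhs => rw [hs]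
      exact map_sum p.mkQ _ s
  smul_mem := by
    rintro i n r _ hr ⟨x, hx, rfl⟩
    exact ⟨r • x, M.smul_mem hr hx, rfl⟩

/-- The projection onto the quotient by a homogeneous submodule. -/
def quotπ {M : GrMod 𝒜} (p : Submodule R M) (hp : IsHomogeneous p) : M ⟶ quot p hp :=
  homMk (N := quot p hp) p.mkQ fun _ x h => ⟨x, h, rfl⟩

theorem isHomogeneous_ker {M N : GrMod 𝒜} (f : M ⟶ N) :
    IsHomogeneous (LinearMap.ker (lin f)) := fun x hx n => by
  rw [LinearMap.mem_ker] at hx ⊢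
  rw [lin_proj, hx, map_zero]

theorem isHomogeneous_range {M N : GrMod 𝒜} (f : M ⟶ N) :
    IsHomogeneous (LinearMap.range (lin f)) := by
  rintro _ ⟨x, rfl⟩ n
  exact ⟨M.proj n x, lin_proj f n x⟩

/-- The kernel of a homogeneous homomorphism is a kernel in the category of graded modules. -/
def kernelIsLimit {M N : GrMod 𝒜} (f : M ⟶ N) :
    IsLimit (KernelFork.ofι (f := f) (subι _ (isHomogeneous_ker f))
      (hom_ext fun x => x.2)) :=
  KernelFork.IsLimit.ofι _ _
    (fun g hg => homMk (N := sub _ (isHomogeneous_ker f))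
      ((lin g).codRestrict _ fun x => LinearMap.congr_fun (congrArg lin hg) x)
      fun _ _ h => lin_mem g h)
    (fun _ _ => rfl)
    (fun _ _ _ hm => hom_ext fun x =>
      Subtype.ext (LinearMap.congr_fun (congrArg lin hm) x))

/-- The quotient by the image is a cokernel in the category of graded modules. -/
def cokernelIsColimit {M N : GrMod 𝒜} (f : M ⟶ N) :
    IsColimit (CokernelCofork.ofπ (f := f) (quotπ _ (isHomogeneous_range f))
      (hom_ext fun x => (Submodule.Quotient.mk_eq_zero _).2 ⟨x, rfl⟩)) :=
  CokernelCofork.IsColimit.ofπ _ _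
    (fun g hg => homMk (M := quot _ (isHomogeneous_range f))
      ((LinearMap.range (lin f)).liftQ (lin g) (by
        rintro _ ⟨x, rfl⟩
        exact LinearMap.congr_fun (congrArg lin hg) x))
      (by
        rintro n _ ⟨x, hx, rfl⟩
        exact lin_mem g hx))
    (fun _ _ => rfl)
    (fun _ _ m hm => hom_ext fun x => by
      obtain ⟨x, rfl⟩ := (LinearMap.range (lin f)).mkQ_surjective x
      exact LinearMap.congr_fun (congrArg lin hm) x)

instance : HasKernels (GrMod 𝒜) where
  has_limit f := ⟨_, kernelIsLimit f⟩

instance : HasCokernels (GrMod 𝒜) where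
  has_colimit f := ⟨_, cokernelIsColimit f⟩

theorem injective_of_mono {M N : GrMod 𝒜} (f : M ⟶ N) [Mono f] :
    Function.Injective (lin f) := by
  rw [← LinearMap.ker_eq_bot, Submodule.eq_bot_iff]
  intro x hx
  have h : subι _ (isHomogeneous_ker f) = 0 := by
    rw [← cancel_mono f, zero_comp]
    exact hom_ext fun x => x.2
  exact LinearMap.congr_fun (congrArg lin h) (⟨x, hx⟩ : LinearMap.ker (lin f))

theorem mono_of_injective {M N : GrMod 𝒜} (f : M ⟶ N) (hf : Function.Injective (lin f)) :
    Mono f :=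
  ⟨fun _ _ h => hom_ext fun x => hf (LinearMap.congr_fun (congrArg lin h) x)⟩

theorem surjective_of_epi {M N : GrMod 𝒜} (f : M ⟶ N) [Epi f] :
    Function.Surjective (lin f) := by
  intro y
  have h : quotπ _ (isHomogeneous_range f) = 0 := by
    rw [← cancel_epi f, comp_zero]
    exact hom_ext fun x => (Submodule.Quotient.mk_eq_zero _).2 ⟨x, rfl⟩
  exact (Submodule.Quotient.mk_eq_zero (LinearMap.range (lin f))).1
    (LinearMap.congr_fun (congrArg lin h) y)

theorem mem_deg_of_lin_mem {M N : GrMod 𝒜} (f : M ⟶ N) (hf : Function.Injective (lin f))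
    {n : ℤ} {x : M} (h : lin f x ∈ N.deg n) : x ∈ M.deg n := by
  have : M.proj n x = x := hf (by rw [lin_proj, proj_same h])
  rw [← this]
  exact M.proj_mem n x

/-- A monomorphism is a kernel of the projection onto the quotient by its image. -/
@[reducible]
def normalMono {M N : GrMod 𝒜} (f : M ⟶ N) [Mono f] : NormalMono f where
  Z := quot _ (isHomogeneous_range f)
  g := quotπ _ (isHomogeneous_range f)
  w := hom_ext fun x => (Submodule.Quotient.mk_eq_zero _).2 ⟨x, rfl⟩
  isLimit := KernelFork.IsLimit.ofι _ _
    (fun {P} g hg => homMk (M := P)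
      ((LinearEquiv.ofInjective (lin f) (injective_of_mono f)).symm.toLinearMap.comp
        ((lin g).codRestrict (LinearMap.range (lin f)) fun x =>
          (Submodule.Quotient.mk_eq_zero _).1 (LinearMap.congr_fun (congrArg lin hg) x)))
      (by
        intro n x hx
        apply mem_deg_of_lin_mem f (injective_of_mono f)
        have h := congrArg Subtype.val
          ((LinearEquiv.ofInjective (lin f) (injective_of_mono f)).apply_symm_apply
            ((lin g).codRestrict (LinearMap.range (lin f)) (fun x =>
              (Submodule.Quotient.mk_eq_zero _).1
                (LinearMap.congr_fun (congrArg lin hg) x)) x))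
        refine (congrArg (fun y => y ∈ N.deg n) h).mpr ?_
        exact lin_mem g hx))
    (fun g hg => hom_ext fun x => congrArg Subtype.val
      ((LinearEquiv.ofInjective (lin f) (injective_of_mono f)).apply_symm_apply _))
    (fun g hg m hm => by
      rw [← cancel_mono f, hm]
      exact hom_ext fun x => (congrArg Subtype.val
        ((LinearEquiv.ofInjective (lin f) (injective_of_mono f)).apply_symm_apply
          ((lin g).codRestrict (LinearMap.range (lin f)) (fun x =>
            (Submodule.Quotient.mk_eq_zero _).1
              (LinearMap.congr_fun (congrArg lin hg) x)) x))).symm)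

/-- An epimorphism is a cokernel of the inclusion of its kernel. -/
@[reducible]
def normalEpi {M N : GrMod 𝒜} (f : M ⟶ N) [Epi f] : NormalEpi f where
  W := sub _ (isHomogeneous_ker f)
  g := subι _ (isHomogeneous_ker f)
  w := hom_ext fun x => x.2
  isColimit := CokernelCofork.IsColimit.ofπ _ _
    (fun {P} g hg => homMk (N := P)
      (((LinearMap.ker (lin f)).liftQ (lin g) (fun x hx =>
        LinearMap.congr_fun (congrArg lin hg) (⟨x, hx⟩ : LinearMap.ker (lin f)))).comp
        ((lin f).quotKerEquivOfSurjective (surjective_of_epi f)).symm.toLinearMap)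
      (by
        intro n y hy
        obtain ⟨x, rfl⟩ := surjective_of_epi f y
        have hx : lin f x = lin f (M.proj n x) := by rw [lin_proj, proj_same hy]
        rw [hx]
        have h : ((lin f).quotKerEquivOfSurjective (surjective_of_epi f)).symm
            (lin f (M.proj n x)) = (LinearMap.ker (lin f)).mkQ (M.proj n x) :=
          (LinearEquiv.symm_apply_eq _).2 rfl
        rw [LinearMap.comp_apply, LinearEquiv.coe_coe, h]
        exact lin_mem g (M.proj_mem n x)))
    (fun g hg => hom_ext fun x => by
      have h : ((lin f).quotKerEquivOfSurjective (surjective_of_epi f)).symm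
          (lin f x) = (LinearMap.ker (lin f)).mkQ x :=
        (LinearEquiv.symm_apply_eq _).2 rfl
      rw [lin_comp, lin_homMk, LinearMap.comp_apply, LinearMap.comp_apply,
        LinearEquiv.coe_coe, h]
      rfl)
    (fun g hg m hm => by
      rw [← cancel_epi f, hm]
      refine hom_ext fun x => ?_
      have h : ((lin f).quotKerEquivOfSurjective (surjective_of_epi f)).symm
          (lin f x) = (LinearMap.ker (lin f)).mkQ x :=
        (LinearEquiv.symm_apply_eq _).2 rfl
      rw [lin_comp, lin_homMk, LinearMap.comp_apply, LinearMap.comp_apply,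
        LinearEquiv.coe_coe, h]
      rfl)

/-- The zero graded module. -/
def zeroMod : GrMod 𝒜 where
  carrier := PUnit
  deg _ := ⊤
  isInternal := by
    refine directSum_isInternal_of_proj _ (fun _ => 0) ?_ ?_ ?_ ?_ <;> intros <;> try trivial
    exact ⟨∅, rfl⟩
  smul_mem _ _ := trivial

instance : HasZeroObject (GrMod 𝒜) where
  zero := ⟨zeroMod,
    fun M => ⟨⟨⟨0⟩, fun f => hom_ext fun x => by
      rw [show x = 0 from rfl, map_zero, map_zero]⟩⟩,
    fun M => ⟨⟨⟨0⟩, fun f => hom_ext fun x => rfl⟩⟩⟩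

/-- The direct sum of two graded modules. -/
def prod (M N : GrMod 𝒜) : GrMod 𝒜 where
  carrier := M × N
  deg n := (M.deg n).prod (N.deg n)
  isInternal := by
    classical
    refine directSum_isInternal_of_proj _ (fun n => (M.proj n).prodMap (N.proj n)) ?_ ?_ ?_ ?_
    · exact fun n x => ⟨M.proj_mem n x.1, N.proj_mem n x.2⟩
    · exact fun n x h => Prod.ext (proj_same h.1) (proj_same h.2)
    · exact fun m n x h hmn => Prod.ext (proj_ne h.1 hmn) (proj_ne h.2 hmn)
    · intro x
      obtain ⟨s, hs, hs0⟩ := M.exists_sum_proj x.1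
      obtain ⟨t, ht, ht0⟩ := N.exists_sum_proj x.2
      refine ⟨s ∪ t, Prod.ext ?_ ?_⟩
      · rw [Prod.fst_sum]
        conv_lhs => rw [hs]
        exact Finset.sum_subset Finset.subset_union_left fun n _ hn => hs0 n hn
      · rw [Prod.snd_sum]
        conv_lhs => rw [ht]
        exact Finset.sum_subset Finset.subset_union_right fun n _ hn => ht0 n hn
  smul_mem hr hx := ⟨M.smul_mem hr hx.1, N.smul_mem hr hx.2⟩

instance : HasBinaryBiproducts (GrMod 𝒜) where
  has_binary_biproduct M N := hasBinaryBiproduct_of_total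
    { pt := prod M N
      fst := homMk (M := prod M N) (LinearMap.fst R M N) fun _ _ h => h.1
      snd := homMk (M := prod M N) (LinearMap.snd R M N) fun _ _ h => h.2
      inl := homMk (N := prod M N) (LinearMap.inl R M N) fun n _ h => ⟨h, (N.deg n).zero_mem⟩
      inr := homMk (N := prod M N) (LinearMap.inr R M N) fun n _ h => ⟨(M.deg n).zero_mem, h⟩
      inl_fst := rfl
      inl_snd := rfl
      inr_fst := rfl
      inr_snd := rfl }
    (hom_ext fun x => Prod.ext (add_zero x.1) (zero_add x.2))

instance : Abelian (GrMod 𝒜) where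
  normalMonoOfMono f _ := ⟨normalMono f⟩
  normalEpiOfEpi f _ := ⟨normalEpi f⟩
  has_finite_products := hasFiniteProducts_of_has_binary_and_terminal

/-- The functor forgetting the grading. -/
def forgetGrading (𝒜 : ℕ → AddSubgroup R) : GrMod 𝒜 ⥤ ModuleCat.{u} R where
  obj M := ModuleCat.of R M
  map f := ModuleCat.ofHom (lin f)

instance : (forgetGrading 𝒜).PreservesMonomorphisms where
  preserves f _ := (ModuleCat.mono_iff_injective _).2 (injective_of_mono f)

instance : (forgetGrading 𝒜).ReflectsMonomorphisms where
  reflects f _ := mono_of_injective f ((ModuleCat.mono_iff_injective ((forgetGrading 𝒜).map f)).1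
    inferInstance)

/-- Additive maps out of a graded module agree if they agree on homogeneous elements. -/
theorem addHom_ext {N : GrMod 𝒜} {P : Type*} [AddCommMonoid P] {f g : N →+ P}
    (h : ∀ n, ∀ x ∈ N.deg n, f x = g x) : f = g := by
  ext x
  obtain ⟨s, hs, -⟩ := N.exists_sum_proj x
  rw [hs, map_sum, map_sum]
  exact Finset.sum_congr rfl fun n _ => h n _ (N.proj_mem n x)

theorem lin_ext {N : GrMod 𝒜} {P : Type*} [AddCommGroup P] [Module R P] {f g : N →ₗ[R] P}
    (h : ∀ n, ∀ x ∈ N.deg n, f x = g x) : f = g :=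
  LinearMap.toAddMonoidHom_injective (addHom_ext h)

/-- The additive map out of a graded module with given values on homogeneous elements. -/
def addLift {N : GrMod 𝒜} {P : Type*} [AddCommMonoid P] (f : ℤ → N →+ P) : N →+ P :=
  letI := N.isInternal.chooseDecomposition
  (DirectSum.toAddMonoid fun n => (f n).comp (N.deg n).subtype).comp
    (DirectSum.decomposeAddEquiv N.deg).toAddMonoidHom

theorem addLift_of_mem {N : GrMod 𝒜} {P : Type*} [AddCommMonoid P] (f : ℤ → N →+ P)
    {n : ℤ} {x : N} (h : x ∈ N.deg n) : addLift f x = f n x := by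
  let := N.isInternal.chooseDecomposition
  change DirectSum.toAddMonoid _ (DirectSum.decompose N.deg x) = _
  rw [DirectSum.decompose_of_mem N.deg h, DirectSum.toAddMonoid_of]
  rfl

/-- An additive map that commutes with homogeneous scalars on homogeneous elements is linear. -/
def toLinear [GradedRing 𝒜] {N : GrMod 𝒜} {P : Type*} [AddCommGroup P] [Module R P]
    (f : N →+ P)
    (h : ∀ i, ∀ r ∈ 𝒜 i, ∀ n, ∀ x ∈ N.deg n, f (r • x) = r • f x) : N →ₗ[R] P where
  toFun := f
  map_add' := map_add f
  map_smul' r x := by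
    rw [RingHom.id_apply]
    induction r using DirectSum.Decomposition.inductionOn 𝒜 with
    | zero => rw [zero_smul, map_zero, zero_smul]
    | add r s hr hs => rw [add_smul, map_add, hr, hs, add_smul]
    | @homogeneous i r =>
      have key : f.comp (DistribSMul.toAddMonoidHom N (r : R)) =
          (DistribSMul.toAddMonoidHom P (r : R)).comp f :=
        addHom_ext fun n x hx => h i r r.2 n x hx
      exact DFunLike.congr_fun key x

section Cofree

/-- The group `⨁ M` indexed by `ℤ` that carries the cofree graded module on a module `M`. -/
def CofreeCarrier (_ : ℕ → AddSubgroup R) (M : ModuleCat.{u} R) : Type u := ℤ →₀ M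

instance (M : ModuleCat.{u} R) : AddCommGroup (CofreeCarrier 𝒜 M) :=
  inferInstanceAs (AddCommGroup (ℤ →₀ M))

/-- The element `x` placed in degree `n`. -/
def cofreeSingle (𝒜 : ℕ → AddSubgroup R) (M : ModuleCat.{u} R) (n : ℤ) :
    M →+ CofreeCarrier 𝒜 M :=
  Finsupp.singleAddHom n

theorem cofree_hom_ext {M : ModuleCat.{u} R} {P : Type*} [AddCommMonoid P]
    {f g : CofreeCarrier 𝒜 M →+ P}
    (h : ∀ n x, f (cofreeSingle 𝒜 M n x) = g (cofreeSingle 𝒜 M n x)) : f = g :=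
  Finsupp.addHom_ext h

/-- Additive maps out of the cofree graded module. -/
def cofreeLift {M : ModuleCat.{u} R} {P : Type*} [AddCommMonoid P] (f : ℤ → M →+ P) :
    CofreeCarrier 𝒜 M →+ P :=
  Finsupp.liftAddHom f

theorem cofreeLift_single {M : ModuleCat.{u} R} {P : Type*} [AddCommMonoid P]
    (f : ℤ → M →+ P) (n : ℤ) (x : M) :
    cofreeLift f (cofreeSingle 𝒜 M n x) = f n x :=
  Finsupp.liftAddHom_apply_single f n x

/-- A homogeneous ring element `r` of degree `i` sends `x` in degree `n` to `r • x` in degree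
`i + n`. -/
def cofreeShift (M : ModuleCat.{u} R) (i : ℕ) :
    𝒜 i →+ AddMonoid.End (CofreeCarrier 𝒜 M) where
  toFun r := cofreeLift fun n =>
    (cofreeSingle 𝒜 M ((i : ℤ) + n)).comp (DistribSMul.toAddMonoidHom M (r : R))
  map_zero' := cofree_hom_ext fun n x => by
    rw [cofreeLift_single]
    change cofreeSingle 𝒜 M _ ((0 : R) • x) = 0
    rw [zero_smul, map_zero]
  map_add' r s := cofree_hom_ext fun n x => by
    refine (cofreeLift_single _ n x).trans ?_
    refine Eq.trans ?_ (congrArg₂ (· + ·)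
      (cofreeLift_single (fun n => (cofreeSingle 𝒜 M ((i : ℤ) + n)).comp
        (DistribSMul.toAddMonoidHom M (r : R))) n x)
      (cofreeLift_single (fun n => (cofreeSingle 𝒜 M ((i : ℤ) + n)).comp
        (DistribSMul.toAddMonoidHom M (s : R))) n x)).symm
    change cofreeSingle 𝒜 M _ (((r : R) + (s : R)) • x) = _
    rw [add_smul, map_add]
    rfl

theorem cofreeShift_single (M : ModuleCat.{u} R) (i : ℕ) (r : 𝒜 i) (n : ℤ) (x : M) :
    cofreeShift M i r (cofreeSingle 𝒜 M n x) =
      cofreeSingle 𝒜 M ((i : ℤ) + n) ((r : R) • x) :=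
  cofreeLift_single _ n x

variable [GradedRing 𝒜]

/-- The action of `R` on the cofree graded module. -/
def cofreeAction (M : ModuleCat.{u} R) : R →+* AddMonoid.End (CofreeCarrier 𝒜 M) :=
  (DirectSum.toSemiring (A := fun i => 𝒜 i) (R := AddMonoid.End (CofreeCarrier 𝒜 M))
    (cofreeShift M)
    (cofree_hom_ext fun n x => by
      refine (cofreeShift_single M 0 _ n x).trans ?_
      change cofreeSingle 𝒜 M (((0 : ℕ) : ℤ) + n) ((1 : R) • x) = cofreeSingle 𝒜 M n x
      simp)
    (fun {i j} r s => cofree_hom_ext fun n x => by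
      change _ = cofreeShift M i r (cofreeShift M j s _)
      rw [cofreeShift_single, cofreeShift_single]
      refine (cofreeShift_single M (i + j) _ n x).trans ?_
      change cofreeSingle 𝒜 M (((i + j : ℕ) : ℤ) + n) (((r : R) * (s : R)) • x) = _
      rw [mul_smul, Nat.cast_add, add_assoc])).comp
    (DirectSum.decomposeRingEquiv 𝒜).toRingHom

instance (M : ModuleCat.{u} R) : Module R (CofreeCarrier 𝒜 M) :=
  Module.compHom _ (cofreeAction (𝒜 := 𝒜) M)

theorem cofree_smul_single (M : ModuleCat.{u} R) {i : ℕ} {r : R} (hr : r ∈ 𝒜 i) (n : ℤ)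
    (x : M) :
    r • cofreeSingle 𝒜 M n x = cofreeSingle 𝒜 M ((i : ℤ) + n) (r • x) := by
  have h : DirectSum.decomposeRingEquiv 𝒜 r = DirectSum.of (fun i => 𝒜 i) i ⟨r, hr⟩ :=
    DirectSum.decompose_of_mem 𝒜 hr
  have h' : cofreeAction (𝒜 := 𝒜) M r = cofreeShift M i ⟨r, hr⟩ := by
    rw [cofreeAction, RingHom.comp_apply]
    refine (congrArg _ h).trans ?_
    exact DirectSum.toSemiring_of _ _ _ i _
  change cofreeAction (𝒜 := 𝒜) M r _ = _
  rw [h', cofreeShift_single]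

/-- The cofree graded module on a module `M`, with every component equal to `M`. -/
def cofree (𝒜 : ℕ → AddSubgroup R) [GradedRing 𝒜] (M : ModuleCat.{u} R) : GrMod 𝒜 where
  carrier := CofreeCarrier 𝒜 M
  deg n := (cofreeSingle 𝒜 M n).range
  isInternal := by
    refine directSum_isInternal_of_proj _
      (fun n => (cofreeSingle 𝒜 M n).comp (Finsupp.applyAddHom n : (ℤ →₀ M) →+ M)) ?_ ?_ ?_ ?_
    · exact fun n x => ⟨_, rfl⟩
    · rintro n _ ⟨x, rfl⟩
      exact congrArg (cofreeSingle 𝒜 M n) Finsupp.single_eq_same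
    · rintro m n _ ⟨x, rfl⟩ hmn
      exact (congrArg (cofreeSingle 𝒜 M n) (Finsupp.single_eq_of_ne (Ne.symm hmn))).trans
        (map_zero _)
    · exact fun x => ⟨Finsupp.support (M := M) x, (Finsupp.sum_single (M := M) x).symm⟩
  smul_mem := by
    rintro i n r _ hr ⟨x, rfl⟩
    exact ⟨r • x, (cofree_smul_single M hr n x).symm⟩

/-- The sum of the coordinates of an element of the cofree graded module. -/
def cofreeCounit (𝒜 : ℕ → AddSubgroup R) [GradedRing 𝒜] (M : ModuleCat.{u} R) :
    cofree 𝒜 M →ₗ[R] M :=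
  toLinear (N := cofree 𝒜 M) (cofreeLift (𝒜 := 𝒜) fun _ => AddMonoidHom.id M) (by
    rintro i r hr n _ ⟨x, rfl⟩
    refine (congrArg (cofreeLift (𝒜 := 𝒜) fun _ => AddMonoidHom.id M)
      (cofree_smul_single M hr n x)).trans ?_
    rw [cofreeLift_single]
    exact congrArg (r • ·) (cofreeLift_single (fun _ => AddMonoidHom.id M) n x).symm)

theorem cofreeCounit_single (M : ModuleCat.{u} R) (n : ℤ) (x : M) :
    cofreeCounit 𝒜 M (cofreeSingle 𝒜 M n x) = x :=
  cofreeLift_single _ n x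

/-- The homogeneous map into a cofree graded module that corresponds to a linear map. -/
def toCofree {N : GrMod 𝒜} {M : ModuleCat.{u} R} (f : N →ₗ[R] M) : N ⟶ cofree 𝒜 M :=
  homMk (N := cofree 𝒜 M)
    (toLinear (P := cofree 𝒜 M)
      (addLift fun n => (cofreeSingle 𝒜 M n).comp f.toAddMonoidHom) (by
        intro i r hr n x hx
        refine (addLift_of_mem _ (N.smul_mem hr hx)).trans ?_
        refine Eq.trans ?_ (congrArg (fun y : cofree 𝒜 M => r • y)
          (addLift_of_mem _ hx)).symm
        refine Eq.trans ?_ (cofree_smul_single M hr n (f x)).symm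
        exact congrArg (cofreeSingle 𝒜 M _) (map_smul f r x)))
    (by
      intro n x hx
      exact ⟨f x, (addLift_of_mem (fun n => (cofreeSingle 𝒜 M n).comp f.toAddMonoidHom)
        hx).symm⟩)

theorem lin_toCofree {N : GrMod 𝒜} {M : ModuleCat.{u} R} (f : N →ₗ[R] M) {n : ℤ} {x : N}
    (hx : x ∈ N.deg n) : lin (toCofree f) x = cofreeSingle 𝒜 M n (f x) :=
  addLift_of_mem _ hx

/-- Linear maps out of `N` correspond to homogeneous maps into a cofree graded module. -/
def cofreeEquiv (N : GrMod 𝒜) (M : ModuleCat.{u} R) :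
    ((forgetGrading 𝒜).obj N ⟶ M) ≃ (N ⟶ cofree 𝒜 M) where
  toFun f := toCofree (N := N) f.hom
  invFun g := ModuleCat.ofHom ((cofreeCounit 𝒜 M).comp (lin g))
  left_inv f := ModuleCat.hom_ext <| lin_ext (N := N) fun n x hx =>
    (congrArg (cofreeCounit 𝒜 M) (lin_toCofree (N := N) f.hom hx)).trans
      (cofreeCounit_single M n _)
  right_inv g := lin_injective <| lin_ext fun n x hx => by
    refine (lin_toCofree _ hx).trans ?_
    obtain ⟨y, hy⟩ := lin_mem g hx
    change cofreeSingle 𝒜 M n (cofreeCounit 𝒜 M (lin g x)) = lin g x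
    rw [← hy]
    exact congrArg (cofreeSingle 𝒜 M n) (cofreeCounit_single M n y)

/-- The cofree graded module is right adjoint to forgetting the grading. -/
def cofreeAdjunction (𝒜 : ℕ → AddSubgroup R) [GradedRing 𝒜] :=
  Adjunction.adjunctionOfEquivRight (F := forgetGrading 𝒜) (cofreeEquiv (𝒜 := 𝒜))
    (fun _ N _ f g => lin_injective <| lin_ext fun _ _ hx =>
      (lin_toCofree _ hx).trans (lin_toCofree (N := N) g.hom (lin_mem f hx)).symm)

instance : EnoughInjectives (GrMod 𝒜) :=
  EnoughInjectives.of_adjunction (cofreeAdjunction 𝒜)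

end Cofree

theorem proj_smul (N : GrMod 𝒜) {i : ℕ} {r : R} (hr : r ∈ 𝒜 i) (x : N) (n : ℤ) :
    N.proj ((i : ℤ) + n) (r • x) = r • N.proj n x := by
  have h : (N.proj ((i : ℤ) + n)).comp (DistribSMul.toAddMonoidHom N r) =
      (DistribSMul.toAddMonoidHom N r).comp (N.proj n) := by
    refine addHom_ext fun m x hx => ?_
    change N.proj _ (r • x) = r • N.proj n x
    by_cases hmn : m = n
    · subst hmn
      rw [proj_same hx, proj_same (N.smul_mem hr hx)]
    · rw [proj_ne hx hmn, smul_zero]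
      exact proj_ne (N.smul_mem hr hx) (by omega)
  exact DFunLike.congr_fun h x

section Torsion

theorem mem_torsion_iff {M : Type*} [AddCommGroup M] [Module R M] (I J : Ideal R) (x : M) :
    (∀ᶠ n : ℕ in Filter.atTop,
      I ^ n • Submodule.span R {x} ≤ J • Submodule.span R {x}) ↔
    ∃ n : ℕ, I ^ n ≤ Ideal.torsionOf R M x ⊔ J := by
  have key : ∀ K : Ideal R, K • Submodule.span R {x} ≤ J • Submodule.span R {x} ↔
      K ≤ Ideal.torsionOf R M x ⊔ J := by
    intro K
    constructor
    · intro h a ha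
      have h1 : a • x ∈ J • Submodule.span R {x} :=
        h (Submodule.smul_mem_smul ha (Submodule.mem_span_singleton_self x))
      obtain ⟨b, hb, hbx⟩ := Submodule.mem_smul_span_singleton.1 h1
      refine Submodule.mem_sup.2 ⟨a - b, ?_, b, hb, sub_add_cancel a b⟩
      rw [Ideal.mem_torsionOf_iff, sub_smul, hbx, sub_self]
    · intro h y hy
      obtain ⟨a, ha, rfl⟩ := Submodule.mem_smul_span_singleton.1 hy
      obtain ⟨c, hc, b, hb, rfl⟩ := Submodule.mem_sup.1 (h ha)
      rw [Ideal.mem_torsionOf_iff] at hc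
      exact Submodule.mem_smul_span_singleton.2 ⟨b, hb, by rw [add_smul, hc, zero_add]⟩
  simp only [key]
  constructor
  · exact fun h => h.exists
  · rintro ⟨n, hn⟩
    filter_upwards [Filter.eventually_ge_atTop n] with m hm
    exact (Ideal.pow_le_pow_right hm).trans hn

/-- The `(I, J)`-torsion submodule `{x | I ^ n x ⊆ J x for n ≫ 0}` of a module. -/
def torsion (I J : Ideal R) (M : Type*) [AddCommGroup M] [Module R M] : Submodule R M where
  carrier := {x | ∀ᶠ n : ℕ in Filter.atTop,
    I ^ n • Submodule.span R {x} ≤ J • Submodule.span R {x}}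
  zero_mem' := by
    refine (mem_torsion_iff I J 0).2 ⟨0, le_sup_of_le_left fun a _ => ?_⟩
    rw [Ideal.mem_torsionOf_iff, smul_zero]
  add_mem' := by
    intro x y hx hy
    obtain ⟨m, hm⟩ := (mem_torsion_iff I J x).1 hx
    obtain ⟨n, hn⟩ := (mem_torsion_iff I J y).1 hy
    refine (mem_torsion_iff I J (x + y)).2 ⟨m + n, ?_⟩
    rw [pow_add]
    refine (Ideal.mul_mono hm hn).trans ?_
    rw [Ideal.sup_mul]
    refine sup_le ?_ (le_sup_of_le_right Ideal.mul_le_left)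
    rw [Ideal.mul_sup]
    refine sup_le (le_sup_of_le_left (Ideal.mul_le_inf.trans ?_))
      (le_sup_of_le_right Ideal.mul_le_right)
    intro a ha
    have h1 := (Ideal.mem_torsionOf_iff x a).1 ha.1
    have h2 := (Ideal.mem_torsionOf_iff y a).1 ha.2
    rw [Ideal.mem_torsionOf_iff, smul_add, h1, h2, add_zero]
  smul_mem' := by
    intro r x hx
    obtain ⟨n, hn⟩ := (mem_torsion_iff I J x).1 hx
    refine (mem_torsion_iff I J (r • x)).2 ⟨n, hn.trans (sup_le_sup_right ?_ J)⟩
    intro a ha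
    rw [Ideal.mem_torsionOf_iff] at ha ⊢
    rw [smul_comm, ha, smul_zero]

theorem map_mem_torsion (I J : Ideal R) {M N : Type*} [AddCommGroup M] [Module R M]
    [AddCommGroup N] [Module R N] (f : M →ₗ[R] N) {x : M} (hx : x ∈ torsion I J M) :
    f x ∈ torsion I J N := by
  obtain ⟨n, hn⟩ := (mem_torsion_iff I J x).1 hx
  refine (mem_torsion_iff I J (f x)).2 ⟨n, hn.trans (sup_le_sup_right ?_ J)⟩
  intro a ha
  rw [Ideal.mem_torsionOf_iff] at ha ⊢
  rw [← map_smul, ha, map_zero]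

variable [GradedRing 𝒜]

open DirectSum in
/-- If `y` kills `x` then the lowest component of `y` kills the lowest component of `x`. -/
theorem lowest_smul_lowest {M : GrMod 𝒜} {y : R} {x : M} (h : y • x = 0) (d : ℕ) (e : ℤ)
    (hy : ∀ i < d, (decompose 𝒜 y i : R) = 0) (hx : ∀ m < e, M.proj m x = 0) :
    (decompose 𝒜 y d : R) • M.proj e x = 0 := by
  classical
  have h1 : M.proj ((d : ℤ) + e) (y • x) = 0 := by rw [h, map_zero]
  have h2 : ∀ i : ℕ, M.proj ((d : ℤ) + e) ((decompose 𝒜 y i : R) • x) =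
      (decompose 𝒜 y i : R) • M.proj ((d : ℤ) + e - i) x := by
    intro i
    rw [← proj_smul M (decompose 𝒜 y i).2, add_sub_cancel]
  rw [← sum_support_decompose 𝒜 y, Finset.sum_smul, map_sum] at h1
  simp only [h2] at h1
  by_cases hd : d ∈ (decompose 𝒜 y).support
  · rw [Finset.sum_eq_single_of_mem d hd] at h1
    · rwa [add_sub_cancel_left] at h1
    · intro i _ hi
      rcases lt_or_gt_of_ne hi with hlt | hgt
      · rw [hy i hlt, zero_smul]
      · rw [hx _ (by omega), smul_zero]
  · have h0 : decompose 𝒜 y d = 0 := by simpa using hd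
    rw [h0]
    simp

open DirectSum in
/-- If `y` kills `x` then some power of the lowest component of `y` kills `x`. -/
theorem lowest_pow_smul {M : GrMod 𝒜} {y : R} {x : M} (h : y • x = 0) (d : ℕ)
    (hy : ∀ i < d, (decompose 𝒜 y i : R) = 0) :
    ∃ k : ℕ, (decompose 𝒜 y d : R) ^ k • x = 0 := by
  have step : ∀ (l : ℕ) (e t : ℤ) (x : M), y • x = 0 → (∀ m < e, M.proj m x = 0) →
      (∀ m, t ≤ m → M.proj m x = 0) → t - e ≤ l →
      ∃ k : ℕ, (decompose 𝒜 y d : R) ^ k • x = 0 := by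
    intro l
    induction l with
    | zero =>
      intro e t x _ he ht hl
      refine ⟨0, ?_⟩
      obtain ⟨s, hs, -⟩ := M.exists_sum_proj x
      rw [pow_zero, one_smul, hs]
      refine Finset.sum_eq_zero fun m _ => ?_
      rcases lt_or_ge m e with hm | hm
      · exact he m hm
      · exact ht m (by push_cast at hl; omega)
    | succ l ih =>
      intro e t x hx he ht hl
      have hp : ∀ m, M.proj ((d : ℤ) + m) ((decompose 𝒜 y d : R) • x) =
          (decompose 𝒜 y d : R) • M.proj m x := fun m =>
        proj_smul M (decompose 𝒜 y d).2 x m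
      obtain ⟨k, hk⟩ := ih (d + (e + 1)) (d + t) ((decompose 𝒜 y d : R) • x)
        (by rw [smul_comm, hx, smul_zero])
        (fun m hm => by
          have := hp (m - d)
          rw [add_sub_cancel] at this
          rw [this]
          rcases lt_or_eq_of_le (show m - d ≤ e by omega) with h' | h'
          · rw [he _ h', smul_zero]
          · rw [h']
            exact lowest_smul_lowest hx d e hy he)
        (fun m hm => by
          have := hp (m - d)
          rw [add_sub_cancel] at this
          rw [this, ht _ (by omega), smul_zero])
        (by push_cast at hl ⊢; omega)
      exact ⟨k + 1, by rw [pow_succ, mul_smul, hk]⟩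
  obtain ⟨s, -, hs⟩ := M.exists_sum_proj x
  obtain ⟨b, hb⟩ := s.bddBelow
  obtain ⟨t, ht⟩ := s.bddAbove
  refine step (t + 1 - b).toNat b (t + 1) x h (fun m hm => hs m fun hms => ?_)
    (fun m hm => hs m fun hms => ?_) (Int.self_le_toNat _)
  · exact absurd (hb hms) (by omega)
  · exact absurd (ht hms) (by omega)

open DirectSum in
theorem lowest_pow_smul_of_pow {M : GrMod 𝒜} {y : R} (d : ℕ)
    (hy : ∀ i < d, (decompose 𝒜 y i : R) = 0) (s : ℕ) :
    ∀ x : M, y ^ s • x = 0 → ∃ k : ℕ, (decompose 𝒜 y d : R) ^ k • x = 0 := by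
  induction s with
  | zero =>
    intro x hx
    exact ⟨0, by simpa using hx⟩
  | succ s ih =>
    intro x hx
    obtain ⟨k, hk⟩ := ih (y • x) (by rw [← mul_smul, ← pow_succ, hx])
    obtain ⟨l, hl⟩ := lowest_pow_smul (x := (decompose 𝒜 y d : R) ^ k • x)
      (by rw [smul_comm, hk]) d hy
    exact ⟨l + k, by rw [pow_add, mul_smul, hl]⟩

open DirectSum in
/-- The radical of the annihilator of an element of a graded module is homogeneous. -/
theorem decompose_mem_radical {M : GrMod 𝒜} {y : R} {x : M}
    (h : y ∈ (Ideal.torsionOf R M x).radical) (i : ℕ) :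
    (decompose 𝒜 y i : R) ∈ (Ideal.torsionOf R M x).radical := by
  classical
  induction i using Nat.strong_induction_on with
  | _ i ih =>
    set z : R := y - ∑ j ∈ Finset.range i, (decompose 𝒜 y j : R) with hz
    have hzm : z ∈ (Ideal.torsionOf R M x).radical :=
      sub_mem h (sum_mem fun j hj => ih j (Finset.mem_range.1 hj))
    have hzd : ∀ j, (decompose 𝒜 z j : R) =
        if j < i then 0 else (decompose 𝒜 y j : R) := by
      intro j
      have h1 : ∀ a, GradedRing.proj 𝒜 j a = (decompose 𝒜 a j : R) := fun a => rfl
      rw [← h1, ← h1, hz, map_sub, map_sum]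
      split_ifs with hj
      · rw [Finset.sum_eq_single_of_mem j (Finset.mem_range.2 hj), sub_eq_zero]
        · exact (decompose_of_mem_same 𝒜 (decompose 𝒜 y j).2).symm
        · exact fun k _ hk => decompose_of_mem_ne 𝒜 (decompose 𝒜 y k).2 hk
      · rw [Finset.sum_eq_zero, sub_zero]
        intro k hk
        refine decompose_of_mem_ne 𝒜 (decompose 𝒜 y k).2 ?_
        rintro rfl
        exact hj (Finset.mem_range.1 hk)
    obtain ⟨s, hs⟩ := hzm
    obtain ⟨k, hk⟩ := lowest_pow_smul_of_pow (M := M) (y := z) i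
      (fun j hj => by rw [hzd, if_pos hj]) s x ((Ideal.mem_torsionOf_iff x _).1 hs)
    rw [hzd, if_neg (lt_irrefl i)] at hk
    exact ⟨k, (Ideal.mem_torsionOf_iff x _).2 hk⟩

open DirectSum in
theorem torsionOf_le_radical_proj {M : GrMod 𝒜} (x : M) (n : ℤ) :
    Ideal.torsionOf R M x ≤ (Ideal.torsionOf R M (M.proj n x)).radical := by
  classical
  intro y hy
  rw [← sum_support_decompose 𝒜 y]
  refine sum_mem fun i _ => ?_
  obtain ⟨k, hk⟩ := decompose_mem_radical (M := M) (Ideal.le_radical hy) i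
  refine ⟨k, (Ideal.mem_torsionOf_iff _ _).2 ?_⟩
  rw [← proj_smul M (SetLike.pow_mem_graded k (decompose 𝒜 y i).2),
    (Ideal.mem_torsionOf_iff x _).1 hk, map_zero]

/-- The torsion submodule of a graded module over a Noetherian graded ring is homogeneous. -/
theorem isHomogeneous_torsion [IsNoetherianRing R] (I J : Ideal R) (M : GrMod 𝒜) :
    IsHomogeneous (torsion I J M) := by
  intro x hx n
  obtain ⟨k, hk⟩ := (mem_torsion_iff I J x).1 hx
  refine (mem_torsion_iff I J _).2 ?_
  apply Ideal.exists_pow_le_of_le_radical_of_fg _ (IsNoetherian.noetherian I)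
  intro a ha
  have h1 : a ^ k ∈ (Ideal.torsionOf R M (M.proj n x) ⊔ J).radical := by
    refine (sup_le ?_ ?_ : Ideal.torsionOf R M x ⊔ J ≤ _) (hk (Ideal.pow_mem_pow ha k))
    · exact (torsionOf_le_radical_proj x n).trans (Ideal.radical_mono le_sup_left)
    · exact le_sup_right.trans Ideal.le_radical
  exact Ideal.radical_isRadical _ ⟨k, h1⟩

/-- The torsion functor `Γ_{I,J}` on the category of graded modules. -/
def torsionFunctor (𝒜 : ℕ → AddSubgroup R) [GradedRing 𝒜] [IsNoetherianRing R]
    (I J : Ideal R) : GrMod 𝒜 ⥤ GrMod 𝒜 where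
  obj M := sub (torsion I J M) (isHomogeneous_torsion I J M)
  map {M N} f := homMk (M := sub (torsion I J M) (isHomogeneous_torsion I J M))
    (N := sub (torsion I J N) (isHomogeneous_torsion I J N))
    ((lin f).restrict fun _ hx => map_mem_torsion I J (lin f) hx)
    fun _ _ hx => lin_mem f hx

instance [IsNoetherianRing R] (I J : Ideal R) : (torsionFunctor 𝒜 I J).Additive where
  map_add := rfl

/-- The graded local cohomology module `H^i_{I,J}(M)`: the `i`-th right derived functor of
`Γ_{I,J}` on the category of graded modules. -/
def localCohomology [IsNoetherianRing R] (I J : Ideal R) (i : ℕ) (M : GrMod 𝒜) : GrMod 𝒜 :=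
  ((torsionFunctor 𝒜 I J).rightDerived i).obj M

end Torsion

/-- The homogeneous components of a graded module are modules over the ring of elements of
degree `0`. -/
instance [GradedRing 𝒜] (M : GrMod 𝒜) (n : ℤ) : Module (𝒜 0) (M.deg n) where
  smul r x := ⟨(r : R) • (x : M), by simpa using M.smul_mem r.2 x.2⟩
  one_smul x := Subtype.ext (one_smul R (x : M))
  mul_smul r s x := Subtype.ext (mul_smul (r : R) (s : R) (x : M))
  smul_zero r := Subtype.ext (smul_zero (r : R))
  smul_add r x y := Subtype.ext (smul_add (r : R) (x : M) (y : M))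
  add_smul r s x := Subtype.ext (add_smul (r : R) (s : R) (x : M))
  zero_smul x := Subtype.ext (zero_smul R (x : M))

end GrMod

/-- The graded ring `R = ⨁ 𝒜 n` is standard: `R₀` is Noetherian and `R` is generated as an
`R₀`-algebra by finitely many elements of degree `1`. -/
structure IsStandardGraded {R : Type u} [CommRing R] (𝒜 : ℕ → AddSubgroup R)
    [GradedRing 𝒜] : Prop where
  isNoetherianRing_zero : IsNoetherianRing (𝒜 0)
  exists_generators : ∃ s : Finset R, (∀ x ∈ s, x ∈ 𝒜 1) ∧
    Algebra.adjoin (𝒜 0) (s : Set R) = ⊤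

/-- The extension to `R` of an ideal of `R₀`. -/
def extendIdeal {R : Type u} [CommRing R] (𝒜 : ℕ → AddSubgroup R) [GradedRing 𝒜]
    (𝔞 : Ideal (𝒜 0)) : Ideal R :=
  𝔞.map (algebraMap (𝒜 0) R)

/-- The irrelevant ideal `R₊ = ⨁_{n > 0} 𝒜 n`. -/
def irrelevantIdeal {R : Type u} [CommRing R] (𝒜 : ℕ → AddSubgroup R) [GradedRing 𝒜] :
    Ideal R :=
  (HomogeneousIdeal.irrelevant 𝒜).toIdeal

end

/-! Write J = 𝔪₀R and let I be any ideal containing R₊. The vanishing results from two opposite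
properties of multiplication by an element x of R₁ on H^i_{I,J}(M).

It is locally nilpotent. If w is homogeneous and I^k w ⊆ Jw, then R_j ⊆ I^k for j ≥ k. Comparing
components of equal degree gives N ⊆ JN for the finitely generated module N = R_{≥k}w, and a graded
form of Nakayama's lemma over the local ring R₀ kills x^k w (`exists_pow_smul_of_homogeneous`). This
passes from Γ_{I,J} to H^i_{I,J}, whose elements are classes of cycles in Γ_{I,J} of an injective
module (`exists_pow_smul_localCohomology`).

It is injective in large degrees if x is regular on M. The sequence 0 → M(-1) → M → M/xM → 0 makes
its kernel an image of H^{i-1}_{I,J}(M/xM), which vanishes in large degrees by induction on i; for i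
= 0 left exactness suffices. The identification of the induced map with multiplication by x is
`eq_zero_of_smul_eq_zero`.

Noetherian induction (`induction_on_cyclic`) reduces a finitely generated M to a cyclic module Rm in
which each homogeneous ring element kills m or is regular. Either some x in R₁ is regular, or R₁m =
0 and Rm lives in degrees at most deg m. In the second case the local cohomology does too, by
dimension shifting along injective modules concentrated in those degrees
(`localCohomology_deg_eq_bot_of_concentrated`).

The long exact sequence for derived functors comes from the horseshoe lemma. -/

noncomputable section

/-! ### Injective resolutions from exact complexes -/

namespace CategoryTheory.InjectiveResolution

universe v w

variable {C : Type w} [Category.{v} C] [Abelian C]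

/-- The embedding of an object into the term of degree `0` of an injective resolution. -/
def ι₀ {X : C} (I : InjectiveResolution X) : X ⟶ I.cocomplex.X 0 := I.ι.f 0

theorem ι₀_d {X : C} (I : InjectiveResolution X) : I.ι₀ ≫ I.cocomplex.d 0 1 = 0 :=
  I.ι_f_zero_comp_complex_d

instance {X : C} (I : InjectiveResolution X) : Mono I.ι₀ :=
  inferInstanceAs (Mono (I.ι.f 0))

theorem exact_ι₀ {X : C} (I : InjectiveResolution X) : (ShortComplex.mk _ _ I.ι₀_d).Exact :=
  I.exact₀

/-- In degree 0 a quasi-isomorphism from a single object means precisely that `q` is mono and exact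
at `K.X 0`; in positive degrees both homologies vanish. -/
theorem quasiIso_of_exact {X : C} {K : CochainComplex C ℕ} (q : X ⟶ K.X 0) [Mono q]
    (hq : q ≫ K.d 0 1 = 0) (h0 : (ShortComplex.mk _ _ hq).Exact)
    (hK : ∀ n, K.ExactAt (n + 1)) :
    QuasiIso ((CochainComplex.fromSingle₀Equiv K X).symm ⟨q, hq⟩) := by
  refine ⟨fun n => ?_⟩
  cases n with
  | zero =>
    rw [CochainComplex.quasiIsoAt₀_iff, ShortComplex.quasiIso_iff_of_zeros]
    · refine (ShortComplex.exact_and_mono_f_iff_of_iso ?_).2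
        ⟨h0, inferInstanceAs (Mono q)⟩
      have e : ((CochainComplex.fromSingle₀Equiv K X).symm ⟨q, hq⟩).f 0 = q :=
        congrArg Subtype.val ((CochainComplex.fromSingle₀Equiv K X).apply_symm_apply ⟨q, hq⟩)
      exact ShortComplex.isoMk (Iso.refl _) (Iso.refl _) (Iso.refl _)
        ((Category.id_comp q).trans (e.symm.trans (Category.comp_id _).symm))
        ((Category.id_comp (K.d 0 1)).trans (Category.comp_id (K.d 0 1)).symm)
    · exact HomologicalComplex.shape ((CochainComplex.single₀ C).obj X) 0 0 (fun h => by cases h)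
    · exact (HomologicalComplex.isZero_single_obj_X (ComplexShape.up ℕ) 0 X 1
        one_ne_zero).eq_of_tgt _ _
    · exact HomologicalComplex.shape K 0 0 (fun h => by cases h)
  | succ n =>
    rw [quasiIsoAt_iff_exactAt]
    · exact hK n
    · apply CochainComplex.exactAt_succ_single_obj

/-- An exact complex of injective objects is an injective resolution. -/
def ofExact {X : C} (K : CochainComplex C ℕ) (hI : ∀ n, Injective (K.X n)) (q : X ⟶ K.X 0)
    (hm : Mono q) (hq : q ≫ K.d 0 1 = 0) (h0 : (ShortComplex.mk _ _ hq).Exact)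
    (hK : ∀ n, K.ExactAt (n + 1)) : InjectiveResolution X where
  cocomplex := K
  injective := hI
  ι := (CochainComplex.fromSingle₀Equiv K X).symm ⟨q, hq⟩
  quasiIso := quasiIso_of_exact q hq h0 hK

theorem ofExact_ι₀ {X : C} (K : CochainComplex C ℕ) (hI : ∀ n, Injective (K.X n))
    (q : X ⟶ K.X 0) (hm : Mono q) (hq : q ≫ K.d 0 1 = 0) (h0 : (ShortComplex.mk _ _ hq).Exact)
    (hK : ∀ n, K.ExactAt (n + 1)) : (ofExact K hI q hm hq h0 hK).ι₀ = q := by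
  change ((CochainComplex.fromSingle₀Equiv K X).symm ⟨q, hq⟩).f 0 = q
  exact congrArg Subtype.val ((CochainComplex.fromSingle₀Equiv K X).apply_symm_apply ⟨q, hq⟩)

end CategoryTheory.InjectiveResolution

/-! ### The horseshoe lemma -/

namespace Horseshoe

universe v w

variable {C : Type w} [Category.{v} C] [Abelian C] {S : ShortComplex C}

/-- The choice of the next term depends on the relation between the two preceding ones, so the
recursion carries pairs of consecutive terms. It builds the chain map in `exists_twist`. -/
theorem exists_sequence {A : ℕ → Type*} (r : ∀ n, A n → A (n + 1) → Prop) (a₀ : A 0) (a₁ : A 1)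
    (h : r 0 a₀ a₁) (hr : ∀ n a b, r n a b → ∃ c, r (n + 1) b c) :
    ∃ f : ∀ n, A n, f 0 = a₀ ∧ ∀ n, r n (f n) (f (n + 1)) := by
  choose g hg using hr
  let p : ∀ n, {p : A n × A (n + 1) // r n p.1 p.2} := fun n =>
    Nat.rec ⟨(a₀, a₁), h⟩ (fun n p => ⟨(p.1.2, g n p.1.1 p.1.2 p.2), hg n _ _ p.2⟩) n
  exact ⟨fun n => (p n).1.1, rfl, fun n => (p n).2⟩

/-- For a short exact sequence `A ⟶ B ⟶ C` and injective resolutions `I` of `A` and `J` of `C`,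
the chain map `J ⟶ I[1]` that classifies the extension `B`. -/
theorem exists_twist (hS : S.ShortExact) (I : InjectiveResolution S.X₁)
    (J : InjectiveResolution S.X₃) :
    ∃ (τ : ∀ n, J.cocomplex.X n ⟶ I.cocomplex.X (n + 1)) (e : S.X₂ ⟶ I.cocomplex.X 0),
      (∀ n, J.cocomplex.d n (n + 1) ≫ τ (n + 1) = τ n ≫ I.cocomplex.d (n + 1) (n + 2)) ∧
      S.f ≫ e = I.ι₀ ∧ e ≫ I.cocomplex.d 0 1 + S.g ≫ J.ι₀ ≫ τ 0 = 0 := by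
  have := hS.mono_f
  have := hS.epi_g
  obtain ⟨e, he⟩ : ∃ e : S.X₂ ⟶ I.cocomplex.X 0, S.f ≫ e = I.ι₀ :=
    ⟨Injective.factorThru I.ι₀ S.f, Injective.comp_factorThru _ _⟩
  -- The extension `e` of `I.ι₀` need not be a cocycle. Its coboundary vanishes on `S.X₁`, hence
  -- descends to a cocycle `c` on `S.X₃`, which then extends along `J.ι₀`.
  have hc0 : S.f ≫ (-(e ≫ I.cocomplex.d 0 1)) = 0 := by
    rw [Preadditive.comp_neg, reassoc_of% he, I.ι₀_d, neg_zero]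
  obtain ⟨c, hc⟩ : ∃ c : S.X₃ ⟶ I.cocomplex.X 1, S.g ≫ c = -(e ≫ I.cocomplex.d 0 1) :=
    ⟨hS.exact.desc _ hc0, hS.exact.g_desc _ hc0⟩
  have hcd : c ≫ I.cocomplex.d 1 2 = 0 := by
    rw [← cancel_epi S.g, reassoc_of% hc]
    simp
  obtain ⟨τ₀, hτ₀⟩ : ∃ τ₀ : J.cocomplex.X 0 ⟶ I.cocomplex.X 1, J.ι₀ ≫ τ₀ = c :=
    ⟨Injective.factorThru c J.ι₀, Injective.comp_factorThru _ _⟩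
  have h1 : J.ι₀ ≫ τ₀ ≫ I.cocomplex.d 1 2 = 0 := by rw [reassoc_of% hτ₀, hcd]
  obtain ⟨τ₁, hτ₁⟩ : ∃ τ₁ : J.cocomplex.X 1 ⟶ I.cocomplex.X 2,
      J.cocomplex.d 0 1 ≫ τ₁ = τ₀ ≫ I.cocomplex.d 1 2 :=
    ⟨J.exact_ι₀.descToInjective _ h1, J.exact_ι₀.comp_descToInjective _ h1⟩
  -- The recursion continues because the composite of the last map with the differential of `I`
  -- kills the incoming differential of `J`, so exactness of `J` and injectivity of the terms of `I`
  -- yield the next map.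
  obtain ⟨τ, hτ, hτd⟩ := exists_sequence (A := fun n => J.cocomplex.X n ⟶ I.cocomplex.X (n + 1))
    (fun n a b => J.cocomplex.d n (n + 1) ≫ b = a ≫ I.cocomplex.d (n + 1) (n + 2)) τ₀ τ₁ hτ₁
    (fun n a b hab => by
      have h2 : J.cocomplex.d n (n + 1) ≫ b ≫ I.cocomplex.d (n + 2) (n + 3) = 0 := by
        rw [reassoc_of% hab, HomologicalComplex.d_comp_d, comp_zero]
      exact ⟨(J.exact_succ n).descToInjective _ h2, (J.exact_succ n).comp_descToInjective _ h2⟩)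
  refine ⟨τ, e, hτd, he, ?_⟩
  rw [hτ, hτ₀, hc, add_neg_cancel]

section

variable {K L : CochainComplex C ℕ} (τ : ∀ n, L.X n ⟶ K.X (n + 1))

/-- The differential of the extension of the complex `L` by `K` defined by `τ`. -/
def extD (n : ℕ) : K.X n ⊞ L.X n ⟶ K.X (n + 1) ⊞ L.X (n + 1) :=
  biprod.desc (K.d n (n + 1) ≫ biprod.inl)
    ((((-1 : ℤ) ^ n) • τ n) ≫ biprod.inl + L.d n (n + 1) ≫ biprod.inr)

/-- `τ` commutes with the differentials without a sign; the alternating sign in `extD` makes the two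
off-diagonal terms cancel. -/
theorem extD_comp (hτ : ∀ n, L.d n (n + 1) ≫ τ (n + 1) = τ n ≫ K.d (n + 1) (n + 2)) (n : ℕ) :
    extD τ n ≫ extD τ (n + 1) = 0 := by
  apply biprod.hom_ext'
  · simp [extD]
  · simp [extD, pow_succ, reassoc_of% hτ]

variable (hτ : ∀ n, L.d n (n + 1) ≫ τ (n + 1) = τ n ≫ K.d (n + 1) (n + 2))

/-- The extension of the complex `L` by `K` defined by a chain map `L ⟶ K[1]`. -/
def ext : CochainComplex C ℕ :=
  CochainComplex.of (fun n => K.X n ⊞ L.X n) (extD τ) (extD_comp τ hτ)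

/-- The inclusion into the extension. -/
def inl (n : ℕ) : K.X n ⟶ (ext τ hτ).X n := (biprod.inl : K.X n ⟶ K.X n ⊞ L.X n)

/-- The projection from the extension. -/
def snd (n : ℕ) : (ext τ hτ).X n ⟶ L.X n := (biprod.snd : K.X n ⊞ L.X n ⟶ L.X n)

/-- The section of the projection from the extension. -/
def inr (n : ℕ) : L.X n ⟶ (ext τ hτ).X n := (biprod.inr : L.X n ⟶ K.X n ⊞ L.X n)

/-- The retraction of the inclusion into the extension. -/
def fst (n : ℕ) : (ext τ hτ).X n ⟶ K.X n := (biprod.fst : K.X n ⊞ L.X n ⟶ K.X n)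

theorem inl_fst (n : ℕ) : inl τ hτ n ≫ fst τ hτ n = 𝟙 _ := biprod.inl_fst

theorem inl_snd (n : ℕ) : inl τ hτ n ≫ snd τ hτ n = 0 := biprod.inl_snd

theorem inr_snd (n : ℕ) : inr τ hτ n ≫ snd τ hτ n = 𝟙 _ := biprod.inr_snd

theorem inr_fst (n : ℕ) : inr τ hτ n ≫ fst τ hτ n = 0 := biprod.inr_fst

theorem total (n : ℕ) : fst τ hτ n ≫ inl τ hτ n + snd τ hτ n ≫ inr τ hτ n = 𝟙 _ := biprod.total

theorem inl_d (n : ℕ) : inl τ hτ n ≫ (ext τ hτ).d n (n + 1) =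
    K.d n (n + 1) ≫ inl τ hτ (n + 1) := by
  have h : (ext τ hτ).d n (n + 1) = extD τ n :=
    CochainComplex.of_d (fun n => K.X n ⊞ L.X n) (extD τ) n
  rw [h]
  exact biprod.inl_desc _ _

theorem inr_d (n : ℕ) : inr τ hτ n ≫ (ext τ hτ).d n (n + 1) =
    (((-1 : ℤ) ^ n) • τ n) ≫ inl τ hτ (n + 1) + L.d n (n + 1) ≫ inr τ hτ (n + 1) := by
  have h : (ext τ hτ).d n (n + 1) = extD τ n :=
    CochainComplex.of_d (fun n => K.X n ⊞ L.X n) (extD τ) n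
  rw [h]
  exact biprod.inr_desc _ _

/-- The inclusion into the extension as a chain map. -/
def extInl : K ⟶ ext τ hτ where
  f := inl τ hτ
  comm' i j hij := by
    obtain rfl : i + 1 = j := hij
    exact inl_d τ hτ i

theorem d_snd (n : ℕ) : (ext τ hτ).d n (n + 1) ≫ snd τ hτ (n + 1) =
    snd τ hτ n ≫ L.d n (n + 1) := by
  conv_lhs => rw [← Category.id_comp ((ext τ hτ).d n (n + 1)), ← total]
  simp only [Preadditive.add_comp, Category.assoc, inl_d, inr_d, inl_snd, inr_snd, comp_zero,
    zero_add, Category.comp_id, Preadditive.comp_add]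

theorem d_fst (n : ℕ) : (ext τ hτ).d n (n + 1) ≫ fst τ hτ (n + 1) =
    fst τ hτ n ≫ K.d n (n + 1) + snd τ hτ n ≫ (((-1 : ℤ) ^ n) • τ n) := by
  conv_lhs => rw [← Category.id_comp ((ext τ hτ).d n (n + 1)), ← total]
  simp only [Preadditive.add_comp, Category.assoc, inl_d, inr_d, inl_fst, inr_fst, comp_zero,
    add_zero, Category.comp_id, Preadditive.comp_add]

theorem hom_ext {X : C} {n : ℕ} {f g : X ⟶ (ext τ hτ).X n}
    (h1 : f ≫ fst τ hτ n = g ≫ fst τ hτ n) (h2 : f ≫ snd τ hτ n = g ≫ snd τ hτ n) : f = g := by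
  rw [← Category.comp_id f, ← Category.comp_id g, ← total, Preadditive.comp_add,
    Preadditive.comp_add, ← Category.assoc, h1, ← Category.assoc f, h2, Category.assoc,
    Category.assoc]

/-- The projection from the extension as a chain map. -/
def extSnd : ext τ hτ ⟶ L where
  f := snd τ hτ
  comm' i j hij := by
    obtain rfl : i + 1 = j := hij
    exact (d_snd τ hτ i).symm

/-- The short complex of complexes given by an extension. -/
def extSeq : ShortComplex (CochainComplex C ℕ) :=
  ShortComplex.mk (extInl τ hτ) (extSnd τ hτ) (by
    ext n
    exact inl_snd τ hτ n)

/-- The short exact sequence of complexes given by an extension splits in each degree. -/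
def extSplitting (n : ℕ) :
    ((extSeq τ hτ).map (HomologicalComplex.eval C (ComplexShape.up ℕ) n)).Splitting where
  r := fst τ hτ n
  s := inr τ hτ n
  f_r := inl_fst τ hτ n
  s_g := inr_snd τ hτ n
  id := total τ hτ n

theorem extSeq_shortExact : (extSeq τ hτ).ShortExact :=
  HomologicalComplex.shortExact_of_degreewise_shortExact _ fun n =>
    (extSplitting τ hτ n).shortExact

/-- `F` need not be exact, but an additive functor preserves the splitting in each degree. -/
theorem extSeq_map_shortExact {D : Type*} [Category* D] [Abelian D] (F : C ⥤ D) [F.Additive] :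
    ((extSeq τ hτ).map (F.mapHomologicalComplex (ComplexShape.up ℕ))).ShortExact :=
  HomologicalComplex.shortExact_of_degreewise_shortExact _ fun n =>
    ((extSplitting τ hτ n).map F).shortExact

end

/-- An injective resolution of the middle term of a short exact sequence that is an extension of
injective resolutions of the other two terms. -/
theorem exists_resolution (hS : S.ShortExact) (I : InjectiveResolution S.X₁)
    (J : InjectiveResolution S.X₃) :
    ∃ (Q : InjectiveResolution S.X₂) (f : I.cocomplex ⟶ Q.cocomplex)
      (g : Q.cocomplex ⟶ J.cocomplex) (w : f ≫ g = 0),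
      I.ι₀ ≫ f.f 0 = S.f ≫ Q.ι₀ ∧ Q.ι₀ ≫ g.f 0 = S.g ≫ J.ι₀ ∧
      ∀ {D : Type w} [Category.{v} D] [Abelian D] (F : C ⥤ D) [F.Additive],
        ((ShortComplex.mk f g w).map (F.mapHomologicalComplex (ComplexShape.up ℕ))).ShortExact := by
  have := hS.mono_f
  have := hS.epi_g
  obtain ⟨τ, e, hτ, hfe, hed⟩ := exists_twist hS I J
  -- The augmentation has coordinates `e` and `S.g ≫ J.ι₀`; that it is a cocycle is the last
  -- equation of `exists_twist`.
  obtain ⟨q, hq1, hq2⟩ : ∃ q : S.X₂ ⟶ (ext τ hτ).X 0, q ≫ fst τ hτ 0 = e ∧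
      q ≫ snd τ hτ 0 = S.g ≫ J.ι₀ := by
    refine ⟨e ≫ inl τ hτ 0 + (S.g ≫ J.ι₀) ≫ inr τ hτ 0, ?_, ?_⟩
    · simp [inl_fst, inr_fst]
    · simp [inl_snd, inr_snd]
  have hq : q ≫ (ext τ hτ).d 0 1 = 0 := by
    apply hom_ext
    · rw [Category.assoc, d_fst, Preadditive.comp_add, reassoc_of% hq1, reassoc_of% hq2]
      simpa using hed
    · rw [Category.assoc, d_snd, reassoc_of% hq2, J.ι₀_d]
      simp
  have hmono : Mono q := by
    rw [Preadditive.mono_iff_cancel_zero]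
    intro P x hx
    have h2 : x ≫ S.g = 0 := by
      rw [← cancel_mono J.ι₀, Category.assoc, ← hq2, reassoc_of% hx]
      simp
    obtain ⟨y, rfl⟩ : ∃ y, x = y ≫ S.f := ⟨hS.exact.lift x h2, (hS.exact.lift_f x h2).symm⟩
    have h3 : y = 0 := by
      rw [← cancel_mono I.ι₀, ← hfe, ← hq1, ← Category.assoc S.f, ← Category.assoc,
        ← Category.assoc, hx]
      simp
    rw [h3, zero_comp]
  -- For a cocycle `x`, the second coordinate comes from `S.X₃` and, after a refinement, from some
  -- `b` into `S.X₂`. Then `x - b ≫ q` has second coordinate zero, and its first coordinate is a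
  -- cocycle of `I`, hence comes from `S.X₁`.
  have hexact : (ShortComplex.mk q _ hq).Exact := by
    rw [ShortComplex.exact_iff_exact_up_to_refinements]
    intro P (x : P ⟶ (ext τ hτ).X 0) (hx : x ≫ (ext τ hτ).d 0 1 = 0)
    have hx1 : (x ≫ snd τ hτ 0) ≫ J.cocomplex.d 0 1 = 0 := by
      rw [Category.assoc, ← d_snd, reassoc_of% hx, zero_comp]
    obtain ⟨c, hc⟩ : ∃ c : P ⟶ S.X₃, c ≫ J.ι₀ = x ≫ snd τ hτ 0 :=
      ⟨J.exact_ι₀.lift _ hx1, J.exact_ι₀.lift_f _ hx1⟩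
    obtain ⟨P', π, hπ, b, hb⟩ := surjective_up_to_refinements_of_epi S.g c
    have hz1 : (π ≫ x - b ≫ q) ≫ snd τ hτ 0 = 0 := by
      rw [Preadditive.sub_comp, Category.assoc, Category.assoc, hq2, ← hc, reassoc_of% hb, sub_self]
    have hz2 : (π ≫ x - b ≫ q) ≫ (ext τ hτ).d 0 1 = 0 := by
      rw [Preadditive.sub_comp, Category.assoc, Category.assoc, hx, hq, comp_zero, comp_zero,
        sub_zero]
    have hz3 : ((π ≫ x - b ≫ q) ≫ fst τ hτ 0) ≫ I.cocomplex.d 0 1 = 0 := by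
      have := hz2 =≫ fst τ hτ 1
      rw [Category.assoc, d_fst, Preadditive.comp_add, reassoc_of% hz1, zero_comp, zero_comp,
        add_zero] at this
      rw [Category.assoc, this]
    obtain ⟨a, ha⟩ : ∃ a : P' ⟶ S.X₁, a ≫ I.ι₀ = (π ≫ x - b ≫ q) ≫ fst τ hτ 0 :=
      ⟨I.exact_ι₀.lift _ hz3, I.exact_ι₀.lift_f _ hz3⟩
    refine ⟨P', π, hπ, b + a ≫ S.f, ?_⟩
    change π ≫ x = (b + a ≫ S.f) ≫ q
    rw [Preadditive.add_comp, ← sub_eq_iff_eq_add', Category.assoc]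
    apply hom_ext
    · rw [← ha, Category.assoc, Category.assoc, hq1, hfe]
    · rw [hz1, Category.assoc, Category.assoc, hq2, S.zero_assoc, zero_comp, comp_zero]
  have hK : ∀ n, (ext τ hτ).ExactAt (n + 1) := fun n =>
    (extSeq_shortExact τ hτ).exactAt_X₂ _ (I.cocomplex_exactAt_succ n) (J.cocomplex_exactAt_succ n)
  have hI : ∀ n, Injective ((ext τ hτ).X n) := fun n =>
    inferInstanceAs (Injective (I.cocomplex.X n ⊞ J.cocomplex.X n))
  refine ⟨.ofExact (ext τ hτ) hI q hmono hq hexact hK, extInl τ hτ, extSnd τ hτ, (extSeq τ hτ).zero,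
    ?_, ?_, fun F _ => extSeq_map_shortExact τ hτ F⟩
  · refine Eq.trans ?_ (congrArg (S.f ≫ ·)
      (InjectiveResolution.ofExact_ι₀ (ext τ hτ) hI q hmono hq hexact hK).symm)
    change I.ι₀ ≫ inl τ hτ 0 = S.f ≫ q
    apply hom_ext
    · rw [Category.assoc, Category.assoc, inl_fst, hq1, hfe, Category.comp_id]
    · rw [Category.assoc, Category.assoc, inl_snd, hq2, S.zero_assoc, zero_comp, comp_zero]
  · exact (congrArg (· ≫ snd τ hτ 0)
      (InjectiveResolution.ofExact_ι₀ (ext τ hτ) hI q hmono hq hexact hK)).trans hq2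

end Horseshoe

/-! ### Long exact sequences of homology and of right derived functors -/

namespace CochainComplex

universe v w

variable {D : Type w} [Category.{v} D] [Abelian D] {K L M : CochainComplex D ℕ} {f : K ⟶ L}
  {g : L ⟶ M} {w : f ≫ g = 0}

theorem homologyMap_exact (h : (ShortComplex.mk f g w).ShortExact) (i : ℕ) :
    ∃ w' : HomologicalComplex.homologyMap f i ≫ HomologicalComplex.homologyMap g i = 0,
      (ShortComplex.mk _ _ w').Exact :=
  ⟨_, h.homology_exact₂ i⟩

theorem exists_connecting (h : (ShortComplex.mk f g w).ShortExact) (i : ℕ) :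
    ∃ (δ : M.homology i ⟶ K.homology (i + 1))
      (w' : δ ≫ HomologicalComplex.homologyMap f (i + 1) = 0), (ShortComplex.mk _ _ w').Exact :=
  ⟨h.δ i (i + 1) rfl, h.δ_comp i (i + 1) rfl, h.homology_exact₁ i (i + 1) rfl⟩

/-- No differential enters degree 0, so homology there consists of cycles and a mono of complexes
stays mono. -/
theorem mono_homologyMap_zero (h : (ShortComplex.mk f g w).ShortExact) :
    Mono (HomologicalComplex.homologyMap f 0) := by
  have : Mono f := h.mono_f
  exact HomologicalComplex.mono_homologyMap_of_mono_of_not_rel (c := ComplexShape.up ℕ) f 0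
    (fun j hj => by cases hj)

end CochainComplex

namespace CategoryTheory.InjectiveResolution

universe v w

variable {C : Type w} [Category.{v} C] [Abelian C] [EnoughInjectives C]
  {D : Type w} [Category.{v} D] [Abelian D] (F : C ⥤ D) [F.Additive]

/-- Derived functors are computed by injective resolutions. -/
def rightDerivedIso {X : C} (I : InjectiveResolution X) (i : ℕ) :
    (F.rightDerived i).obj X ≅
      ((F.mapHomologicalComplex (ComplexShape.up ℕ)).obj I.cocomplex).homology i :=
  I.isoRightDerivedObj F i

theorem rightDerivedIso_naturality {X Y : C} (f : X ⟶ Y) (I : InjectiveResolution X)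
    (J : InjectiveResolution Y) (φ : I.cocomplex ⟶ J.cocomplex) (h : I.ι₀ ≫ φ.f 0 = f ≫ J.ι₀)
    (i : ℕ) : (F.rightDerived i).map f ≫ (J.rightDerivedIso F i).hom =
      (I.rightDerivedIso F i).hom ≫ HomologicalComplex.homologyMap
        ((F.mapHomologicalComplex (ComplexShape.up ℕ)).map φ) i :=
  isoRightDerivedObj_hom_naturality f I J φ h F i

end CategoryTheory.InjectiveResolution

namespace CategoryTheory.Functor

universe v w

variable {C : Type w} [Category.{v} C] [Abelian C] [EnoughInjectives C]
  {D : Type w} [Category.{v} D] [Abelian D] (F : C ⥤ D) [F.Additive] {S : ShortComplex C}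

/-- The resolutions of the horseshoe lemma remain a short exact sequence of complexes after applying
`F`; their homology sequence is transported along `rightDerivedIso`. -/
theorem rightDerived_exact (hS : S.ShortExact) (i : ℕ) :
    ∃ w : (F.rightDerived i).map S.f ≫ (F.rightDerived i).map S.g = 0,
      (ShortComplex.mk _ _ w).Exact := by
  let I := InjectiveResolution.of S.X₁
  let J := InjectiveResolution.of S.X₃
  obtain ⟨Q, f, g, w, hf, hg, h⟩ := Horseshoe.exists_resolution hS I J
  obtain ⟨w', hw'⟩ := CochainComplex.homologyMap_exact (h F) i
  have hf' := InjectiveResolution.rightDerivedIso_naturality F S.f I Q f hf i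
  have hg' := InjectiveResolution.rightDerivedIso_naturality F S.g Q J g hg i
  have key : (F.rightDerived i).map S.f ≫ (F.rightDerived i).map S.g = 0 := by
    rw [← cancel_mono (J.rightDerivedIso F i).hom, Category.assoc, hg', reassoc_of% hf', w',
      comp_zero, zero_comp]
  exact ⟨key, (ShortComplex.exact_iff_of_iso (ShortComplex.isoMk (I.rightDerivedIso F i)
    (Q.rightDerivedIso F i) (J.rightDerivedIso F i) hf'.symm hg'.symm)).2 hw'⟩

theorem exists_rightDerived_connecting (hS : S.ShortExact) (i : ℕ) :
    ∃ (δ : (F.rightDerived i).obj S.X₃ ⟶ (F.rightDerived (i + 1)).obj S.X₁)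
      (w : δ ≫ (F.rightDerived (i + 1)).map S.f = 0), (ShortComplex.mk _ _ w).Exact := by
  let I := InjectiveResolution.of S.X₁
  let J := InjectiveResolution.of S.X₃
  obtain ⟨Q, f, g, w, hf, hg, h⟩ := Horseshoe.exists_resolution hS I J
  obtain ⟨δ, w', hw'⟩ := CochainComplex.exists_connecting (h F) i
  have hf' := InjectiveResolution.rightDerivedIso_naturality F S.f I Q f hf (i + 1)
  have key : ((J.rightDerivedIso F i).hom ≫ δ ≫ (I.rightDerivedIso F (i + 1)).inv) ≫
      (F.rightDerived (i + 1)).map S.f = 0 := by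
    rw [← cancel_mono (Q.rightDerivedIso F (i + 1)).hom, Category.assoc, Category.assoc,
      Category.assoc, hf', Iso.inv_hom_id_assoc, w', comp_zero, zero_comp]
  refine ⟨_, key, (ShortComplex.exact_iff_of_iso (ShortComplex.isoMk (J.rightDerivedIso F i)
    (I.rightDerivedIso F (i + 1)) (Q.rightDerivedIso F (i + 1)) ?_ hf'.symm)).2 hw'⟩
  change _ = (_ ≫ _ ≫ _) ≫ _
  rw [Category.assoc, Category.assoc, Iso.inv_hom_id, Category.comp_id]

theorem mono_rightDerived_zero_map (hS : S.ShortExact) : Mono ((F.rightDerived 0).map S.f) := by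
  let I := InjectiveResolution.of S.X₁
  obtain ⟨Q, f, g, w, hf, hg, h⟩ := Horseshoe.exists_resolution hS I
    (InjectiveResolution.of S.X₃)
  have hf' := InjectiveResolution.rightDerivedIso_naturality F S.f I Q f hf 0
  have := CochainComplex.mono_homologyMap_zero (h F)
  have h2 : Mono ((F.rightDerived 0).map S.f ≫ (Q.rightDerivedIso F 0).hom) := by
    rw [hf']
    exact mono_comp _ _
  exact mono_of_mono _ (Q.rightDerivedIso F 0).hom

end CategoryTheory.Functor

/-! ### Degreewise exactness, shifts, and homogeneous multiplication on local cohomology -/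

namespace GrMod

variable {R : Type u} [CommRing R] {𝒜 : ℕ → AddSubgroup R}

/-- Exactness up to refinements, tested on the kernel of `S.g`, gives some preimage of `y`; its
component of degree `n` is still a preimage since morphisms commute with `proj`. -/
theorem exists_lin_eq_of_exact {S : ShortComplex (GrMod 𝒜)} (hS : S.Exact) {n : ℤ} {y : S.X₂}
    (hn : y ∈ S.X₂.deg n) (hy : lin S.g y = 0) : ∃ x ∈ S.X₁.deg n, lin S.f x = y := by
  rw [ShortComplex.exact_iff_exact_up_to_refinements] at hS
  obtain ⟨A, π, hπ, x₁, hx⟩ := hS (subι _ (isHomogeneous_ker S.g)) (hom_ext fun x => x.2)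
  obtain ⟨a, ha⟩ := surjective_of_epi π ⟨y, hy⟩
  refine ⟨S.X₁.proj n (lin x₁ a), S.X₁.proj_mem n _, ?_⟩
  rw [lin_proj]
  have h : lin S.f (lin x₁ a) = y := by
    have h1 := LinearMap.congr_fun (congrArg lin hx) a
    have h2 : lin (subι _ (isHomogeneous_ker S.g)) (lin π a) = y := by
      rw [ha]
      rfl
    exact h1.symm.trans h2
  rw [h, proj_same hn]

theorem shortExact_of_lin (S : ShortComplex (GrMod 𝒜)) (hf : Function.Injective (lin S.f))
    (hg : Function.Surjective (lin S.g)) (h : ∀ x, lin S.g x = 0 → ∃ y, lin S.f y = x) :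
    S.ShortExact where
  mono_f := mono_of_injective _ hf
  epi_g := by
    refine ⟨fun a b hab => hom_ext fun x => ?_⟩
    obtain ⟨y, rfl⟩ := hg x
    exact LinearMap.congr_fun (congrArg lin hab) y
  exact := by
    have := mono_of_injective _ hf
    rw [ShortComplex.exact_iff_exact_up_to_refinements]
    intro A x₂ hx
    have hm : ∀ a, ∃ y, lin S.f y = lin x₂ a := fun a =>
      h _ (LinearMap.congr_fun (congrArg lin hx) a)
    choose y hy using hm
    refine ⟨A, 𝟙 A, inferInstance, homMk (M := A)
      { toFun := y
        map_add' := fun a b => hf (by simp only [hy, map_add])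
        map_smul' := fun r a => hf (by simp only [hy, map_smul, RingHom.id_apply]) }
      (fun n a ha => mem_deg_of_lin_mem S.f hf ?_), hom_ext fun a => ?_⟩
    · change lin S.f (y a) ∈ _
      rw [hy]
      exact lin_mem x₂ ha
    · exact (hy a).symm

/-- The short exact sequence given by a monomorphism and its cokernel. -/
def cokernelSeq {M N : GrMod 𝒜} (f : M ⟶ N) : ShortComplex (GrMod 𝒜) :=
  ShortComplex.mk f (quotπ _ (isHomogeneous_range f))
    (hom_ext fun x => (Submodule.Quotient.mk_eq_zero _).2 ⟨x, rfl⟩)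

theorem cokernelSeq_shortExact {M N : GrMod 𝒜} (f : M ⟶ N) (hf : Function.Injective (lin f)) :
    (cokernelSeq f).ShortExact :=
  shortExact_of_lin _ hf (Submodule.mkQ_surjective _) fun _ hx =>
    (Submodule.Quotient.mk_eq_zero _).1 hx

theorem eq_zero_of_isZero {M : GrMod 𝒜} (h : IsZero M) (x : M) : x = 0 :=
  LinearMap.congr_fun (congrArg lin (h.eq_of_src (𝟙 M) 0)) x

theorem lin_hom_inv {M N : GrMod 𝒜} (e : M ≅ N) (x : M) : lin e.inv (lin e.hom x) = x :=
  LinearMap.congr_fun (congrArg lin e.hom_inv_id) x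

theorem lin_inv_hom {M N : GrMod 𝒜} (e : M ≅ N) (x : N) : lin e.hom (lin e.inv x) = x :=
  LinearMap.congr_fun (congrArg lin e.inv_hom_id) x

/-- The graded module with `deg n` of the shift equal to `deg (n - t)`. -/
def shift (M : GrMod 𝒜) (t : ℤ) : GrMod 𝒜 where
  carrier := M
  deg n := M.deg (n - t)
  isInternal := by
    classical
    refine directSum_isInternal_of_proj _ (fun n => M.proj (n - t)) ?_ ?_ ?_ ?_
    · exact fun n x => M.proj_mem _ x
    · exact fun n x h => proj_same h
    · exact fun m n x h hmn => proj_ne h (by omega)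
    · intro x
      obtain ⟨s, hs, -⟩ := M.exists_sum_proj x
      refine ⟨s.image (· + t), ?_⟩
      rw [Finset.sum_image (by simp)]
      simpa using hs
  smul_mem {i n r x} hr hx := by
    have := M.smul_mem hr hx
    rwa [show (i : ℤ) + n - t = i + (n - t) by ring]

/-- The shift functor. -/
def shiftFunctor (𝒜 : ℕ → AddSubgroup R) (t : ℤ) : GrMod 𝒜 ⥤ GrMod 𝒜 where
  obj M := M.shift t
  map {M N} f := homMk (M := M.shift t) (N := N.shift t) (lin (M := M) (N := N) f)
    fun _ _ hx => lin_mem (M := M) (N := N) f hx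

/-- The shift functors are equivalences. -/
def shiftEquivalence (𝒜 : ℕ → AddSubgroup R) (t : ℤ) : GrMod 𝒜 ≌ GrMod 𝒜 :=
  CategoryTheory.Equivalence.mk (shiftFunctor 𝒜 t) (shiftFunctor 𝒜 (-t))
    (NatIso.ofComponents (fun M =>
      { hom := homMk (M := M) (N := (M.shift t).shift (-t)) LinearMap.id fun n x hx => by
          change x ∈ M.deg (n - -t - t)
          rwa [sub_neg_eq_add, add_sub_cancel_right]
        inv := homMk (N := M) (M := (M.shift t).shift (-t)) LinearMap.id fun n x hx => by
          change x ∈ M.deg (n - -t - t) at hx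
          rwa [sub_neg_eq_add, add_sub_cancel_right] at hx
        hom_inv_id := rfl
        inv_hom_id := rfl }) (fun _ => rfl))
    (NatIso.ofComponents (fun M =>
      { hom := homMk (N := M) (M := (M.shift (-t)).shift t) LinearMap.id fun n x hx => by
          change x ∈ M.deg (n - t - -t) at hx
          rwa [sub_neg_eq_add, sub_add_cancel] at hx
        inv := homMk (M := M) (N := (M.shift (-t)).shift t) LinearMap.id fun n x hx => by
          change x ∈ M.deg (n - t - -t)
          rwa [sub_neg_eq_add, sub_add_cancel]
        hom_inv_id := rfl
        inv_hom_id := rfl }) (fun _ => rfl))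

instance (t : ℤ) : (shiftFunctor 𝒜 t).IsEquivalence :=
  (shiftEquivalence 𝒜 t).isEquivalence_functor

instance (t : ℤ) : (shiftFunctor 𝒜 t).Additive where
  map_add := rfl

instance (t : ℤ) : (shiftFunctor 𝒜 t).PreservesHomology := inferInstance

instance (t : ℤ) (M : GrMod 𝒜) [Injective M] : Injective ((shiftFunctor 𝒜 t).obj M) :=
  ((shiftEquivalence 𝒜 t).map_injective_iff M).2 inferInstance

/-- Multiplication by a homogeneous element of degree `t` as a natural transformation. -/
def shiftSMul {t : ℕ} {r : R} (hr : r ∈ 𝒜 t) : shiftFunctor 𝒜 t ⟶ 𝟭 (GrMod 𝒜) where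
  app M := homMk (M := M.shift t) (N := M) (LinearMap.lsmul R M r) fun n x hx => by
    have := M.smul_mem hr (show x ∈ M.deg (n - t) from hx)
    rwa [add_sub_cancel] at this
  naturality M N f := hom_ext fun x => ((lin f).map_smul r x).symm

theorem shiftSMul_app {t : ℕ} {r : R} (hr : r ∈ 𝒜 t) (M : GrMod 𝒜) (x : M) :
    lin ((shiftSMul hr).app M) x = r • x := rfl

theorem shift_exactAt {K : CochainComplex (GrMod 𝒜) ℕ} {n : ℕ} (h : K.ExactAt n) (t : ℤ) :
    (((shiftFunctor 𝒜 t).mapHomologicalComplex (ComplexShape.up ℕ)).obj K).ExactAt n :=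
  ShortComplex.Exact.map h (shiftFunctor 𝒜 t)

theorem mono_shift_map (t : ℤ) {M N : GrMod 𝒜} (f : M ⟶ N) [Mono f] :
    Mono ((shiftFunctor 𝒜 t).map f) :=
  mono_of_injective _ (injective_of_mono f)

/-- The shift of an injective resolution. -/
def shiftResolution {M : GrMod 𝒜} (I : InjectiveResolution M) (t : ℤ) :
    InjectiveResolution ((shiftFunctor 𝒜 t).obj M) :=
  .ofExact (((shiftFunctor 𝒜 t).mapHomologicalComplex (ComplexShape.up ℕ)).obj I.cocomplex)
    (fun n => inferInstanceAs (Injective ((shiftFunctor 𝒜 t).obj (I.cocomplex.X n))))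
    ((shiftFunctor 𝒜 t).map I.ι₀) (mono_shift_map t I.ι₀)
    (((shiftFunctor 𝒜 t).map_comp _ _).symm.trans
      ((congrArg (shiftFunctor 𝒜 t).map I.ι₀_d).trans ((shiftFunctor 𝒜 t).map_zero _ _)))
    (I.exact_ι₀.map (shiftFunctor 𝒜 t)) (fun n => shift_exactAt (I.cocomplex_exactAt_succ n) t)

theorem shiftResolution_ι₀ {M : GrMod 𝒜} (I : InjectiveResolution M) (t : ℤ) :
    (shiftResolution I t).ι₀ = (shiftFunctor 𝒜 t).map I.ι₀ :=
  InjectiveResolution.ofExact_ι₀ _ _ _ (mono_shift_map t I.ι₀) _ _ _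

/-- Multiplication by a homogeneous element of degree `t` as a chain map. -/
def complexSMul {t : ℕ} {r : R} (hr : r ∈ 𝒜 t) (K : CochainComplex (GrMod 𝒜) ℕ) :
    ((shiftFunctor 𝒜 t).mapHomologicalComplex (ComplexShape.up ℕ)).obj K ⟶ K where
  f n := (shiftSMul hr).app (K.X n)
  comm' i j _ := ((shiftSMul hr).naturality (K.d i j)).symm

/-- The shift is exact, so it commutes with homology, and homology is natural in the functor applied
to the complex. The automorphism `e'` is the comparison isomorphism for the identity functor. -/
theorem exists_homology_shift_iso {t : ℕ} {r : R} (hr : r ∈ 𝒜 t)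
    (K : CochainComplex (GrMod 𝒜) ℕ) (i : ℕ) :
    ∃ (e : (shiftFunctor 𝒜 t).obj (K.homology i) ≅
        (((shiftFunctor 𝒜 t).mapHomologicalComplex (ComplexShape.up ℕ)).obj K).homology i)
      (e' : K.homology i ≅ K.homology i),
      (shiftSMul hr).app (K.homology i) =
        e.hom ≫ HomologicalComplex.homologyMap (complexSMul hr K) i ≫ e'.hom :=
  ⟨((K.sc i).mapHomologyIso (shiftFunctor 𝒜 t)).symm, (K.sc i).mapHomologyIso (𝟭 _),
    NatTrans.app_homology (shiftSMul hr) (K.sc i)⟩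

variable [GradedRing 𝒜] [IsNoetherianRing R] (I J : Ideal R)

/-- Multiplication by `r` is a morphism M(-t) → M. It lifts to the shifted resolution as
multiplication in each term, so up to isomorphism the map it induces on cohomology is multiplication
by `r`, and its injectivity can be transferred. -/
theorem eq_zero_of_smul_eq_zero {t : ℕ} {r : R} (hr : r ∈ 𝒜 t) (i : ℕ) (n : ℤ) (M : GrMod 𝒜)
    (h : ∀ y ∈ (localCohomology I J i ((shiftFunctor 𝒜 t).obj M)).deg (n + t),
      lin (((torsionFunctor 𝒜 I J).rightDerived i).map ((shiftSMul hr).app M)) y = 0 → y = 0)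
    (y : localCohomology I J i M) (hy : y ∈ (localCohomology I J i M).deg n) (hry : r • y = 0) :
    y = 0 := by
  let Q := InjectiveResolution.of M
  let F := torsionFunctor 𝒜 I J
  let K := (F.mapHomologicalComplex (ComplexShape.up ℕ)).obj Q.cocomplex
  have hι : (shiftResolution Q t).ι₀ ≫ (complexSMul hr Q.cocomplex).f 0 =
      (shiftSMul hr).app M ≫ Q.ι₀ :=
    (congrArg (· ≫ (shiftSMul hr).app (Q.cocomplex.X 0)) (shiftResolution_ι₀ Q t)).trans
      ((shiftSMul hr).naturality Q.ι₀)
  have hn := InjectiveResolution.rightDerivedIso_naturality F _ (shiftResolution Q t) Q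
    (complexSMul hr Q.cocomplex) hι i
  obtain ⟨e, e', he⟩ := exists_homology_shift_iso hr K i
  let a := Q.rightDerivedIso F i
  let b := (shiftResolution Q t).rightDerivedIso F i
  let z : K.homology i := lin a.hom y
  have hz : z ∈ (K.homology i).deg n := lin_mem a.hom hy
  -- Degree `n` of the cohomology of `M` is degree `n + t` after the shift, which is why `h` is
  -- assumed there.
  have hz' : z ∈ ((shiftFunctor 𝒜 t).obj (K.homology i)).deg (n + t) := by
    change z ∈ (K.homology i).deg (n + t - t)
    rwa [add_sub_cancel_right]
  have hrz : r • z = 0 :=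
    ((lin a.hom).map_smul r y).symm.trans ((congrArg (lin a.hom) hry).trans (map_zero _))
  have h1 : lin (HomologicalComplex.homologyMap (complexSMul hr K) i) (lin e.hom z) = 0 := by
    rw [← lin_hom_inv e' (lin (HomologicalComplex.homologyMap (complexSMul hr K) i) _)]
    have h2 := LinearMap.congr_fun (congrArg lin he) z
    rw [shiftSMul_app, hrz] at h2
    exact (congrArg (lin e'.inv) h2.symm).trans (map_zero _)
  have h3 : lin b.inv (lin e.hom z) = 0 := by
    refine h _ (lin_mem b.inv (lin_mem e.hom hz')) ?_
    have h4 := LinearMap.congr_fun (congrArg lin hn) (lin b.inv (lin e.hom z))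
    have h5 : lin a.hom (lin ((F.rightDerived i).map ((shiftSMul hr).app M))
        (lin b.inv (lin e.hom z))) = 0 := by
      refine h4.trans ?_
      refine (congrArg (lin (HomologicalComplex.homologyMap (complexSMul hr K) i))
        (lin_inv_hom b (lin e.hom z))).trans h1
    rw [← lin_hom_inv a (lin _ _), h5, map_zero]
  have h6 : lin e.hom z = 0 :=
    (lin_inv_hom b (lin e.hom z)).symm.trans ((congrArg (lin b.hom) h3).trans (map_zero _))
  have h7 : z = 0 := by
    rw [← lin_hom_inv e z, h6]
    exact map_zero _
  rw [← lin_hom_inv a y]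
  exact (congrArg _ h7).trans (map_zero _)

end GrMod

/-! ### Elements of degree 1 act locally nilpotently on local cohomology -/

namespace GrMod

variable {R : Type u} [CommRing R] {𝒜 : ℕ → AddSubgroup R} [GradedRing 𝒜]

open DirectSum in
-- The ring is generated in degree 1. The induction over the generated algebra runs on all
-- components at once, because its elements are not homogeneous.
theorem mem_span_pow (h𝒜 : IsStandardGraded 𝒜) {j : ℕ} {r : R} (hr : r ∈ 𝒜 j) :
    r ∈ Ideal.span (𝒜 1 : Set R) ^ j := by
  classical
  obtain ⟨s, hs, hs'⟩ := h𝒜.exists_generators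
  suffices h : ∀ x ∈ Algebra.adjoin (𝒜 0) (s : Set R), ∀ j,
      (decompose 𝒜 x j : R) ∈ Ideal.span (𝒜 1 : Set R) ^ j by
    have := h r (hs' ▸ Algebra.mem_top) j
    rwa [decompose_of_mem_same 𝒜 hr] at this
  intro x hx
  induction hx using Algebra.adjoin_induction with
  | mem x hx =>
    intro j
    by_cases hj : j = 1
    · subst hj
      rw [decompose_of_mem_same 𝒜 (hs x hx), pow_one]
      exact Ideal.subset_span (hs x hx)
    · rw [decompose_of_mem_ne 𝒜 (hs x hx) (Ne.symm hj)]
      exact zero_mem _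
  | algebraMap a =>
    intro j
    have ha : algebraMap (𝒜 0) R a ∈ 𝒜 0 := a.2
    by_cases hj : j = 0
    · subst hj
      simp
    · rw [decompose_of_mem_ne 𝒜 ha (Ne.symm hj)]
      exact zero_mem _
  | add x y _ _ hx hy =>
    intro j
    rw [decompose_add]
    exact add_mem (hx j) (hy j)
  | mul x y _ _ hx hy =>
    intro j
    rw [decompose_mul, coe_mul_apply]
    refine sum_mem fun p hp => ?_
    rw [← (Finset.mem_filter.1 hp).2, pow_add]
    exact Ideal.mul_mem_mul (hx _) (hy _)

theorem span_le_irrelevantIdeal : Ideal.span (𝒜 1 : Set R) ≤ irrelevantIdeal 𝒜 := by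
  rw [Ideal.span_le]
  intro x hx
  exact (HomogeneousIdeal.mem_irrelevant_iff 𝒜 x).2
    (DirectSum.decompose_of_mem_ne 𝒜 hx one_ne_zero)

open DirectSum in
-- Generators of the extended ideal have degree 0, so taking components only affects the
-- coefficients. The ideal `𝔠` is left free in order to be taken as R_{≥k} later.
theorem decompose_mem_of_mem_extendIdeal {𝔞 : Ideal (𝒜 0)} {b : R} (hb : b ∈ extendIdeal 𝒜 𝔞)
    (j : ℕ) {𝔠 : Ideal R} (h𝔠 : ∀ r ∈ 𝒜 j, r ∈ 𝔠) :
    (decompose 𝒜 b j : R) ∈ extendIdeal 𝒜 𝔞 * 𝔠 := by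
  refine Submodule.closure_induction (p := fun b _ => (decompose 𝒜 b j : R) ∈
    extendIdeal 𝒜 𝔞 * 𝔠) ?_ ?_ ?_ hb
  · simp
  · intro x y _ _ hx hy
    rw [decompose_add]
    exact add_mem hx hy
  · rintro r _ ⟨a, ha, rfl⟩
    have h := coe_decompose_mul_add_of_right_mem 𝒜 (i := j) (a := r)
      (show algebraMap (𝒜 0) R a ∈ 𝒜 0 from a.2)
    rw [add_zero] at h
    rw [smul_eq_mul, h, mul_comm (extendIdeal 𝒜 𝔞)]
    exact Ideal.mul_mem_mul (h𝔠 _ (decompose 𝒜 r j).2) (Ideal.mem_map_of_mem _ ha)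

open DirectSum in
theorem decompose_zero_mem_of_mem_extendIdeal {𝔞 : Ideal (𝒜 0)} {b : R}
    (hb : b ∈ extendIdeal 𝒜 𝔞) : decompose 𝒜 b 0 ∈ 𝔞 := by
  refine Submodule.closure_induction (p := fun b _ => decompose 𝒜 b 0 ∈ 𝔞) ?_ ?_ ?_ hb
  · simp
  · intro x y _ _ hx hy
    rw [decompose_add]
    exact add_mem hx hy
  · rintro r _ ⟨a, ha, rfl⟩
    have h := coe_decompose_mul_add_of_right_mem 𝒜 (i := 0) (a := r)
      (show algebraMap (𝒜 0) R a ∈ 𝒜 0 from a.2)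
    have h' : decompose 𝒜 (r * algebraMap (𝒜 0) R a) 0 = decompose 𝒜 r 0 * a := Subtype.ext h
    rw [smul_eq_mul, h']
    exact Ideal.mul_mem_left _ _ ha

variable [IsNoetherianRing R] [IsLocalRing (𝒜 0)]

open DirectSum in
-- Nakayama's lemma for R_{≥k}w, with the unit extracted from degree 0 because 𝔪₀R need not lie in
-- the Jacobson radical of R.
theorem exists_pow_smul_of_homogeneous (h𝒜 : IsStandardGraded 𝒜) {I : Ideal R}
    (hI : irrelevantIdeal 𝒜 ≤ I) {M : GrMod 𝒜} {n : ℤ} {w : M} (hn : w ∈ M.deg n)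
    (hw : w ∈ torsion I (extendIdeal 𝒜 (IsLocalRing.maximalIdeal (𝒜 0))) M) {x : R}
    (hx : x ∈ 𝒜 1) : ∃ k : ℕ, x ^ k • w = 0 := by
  set J := extendIdeal 𝒜 (IsLocalRing.maximalIdeal (𝒜 0)) with hJ
  obtain ⟨k, hk⟩ := (mem_torsion_iff I J w).1 hw
  -- The ideal R_{≥k}; below, `N` is R_{≥k}w.
  let 𝔠 : Ideal R := Ideal.span {r | ∃ j, k ≤ j ∧ r ∈ 𝒜 j}
  let N : Submodule R M := 𝔠 • Submodule.span R {w}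
  have hN : N ≤ J • N := by
    rw [Submodule.smul_le]
    intro r hr v hv
    obtain ⟨s, rfl⟩ := Submodule.mem_span_singleton.1 hv
    rw [smul_comm r s w]
    refine (J • N).smul_mem s ?_
    clear hv
    induction hr using Submodule.span_induction with
    | zero => rw [zero_smul]; exact zero_mem _
    | add a b _ _ ha hb => rw [add_smul]; exact add_mem ha hb
    | smul a b _ hb => rw [smul_assoc]; exact (J • N).smul_mem a hb
    | mem r hr =>
      obtain ⟨j, hkj, hr⟩ := hr
      have h1 : r ∈ I ^ k := by
        refine Ideal.pow_le_pow_right hkj (Ideal.pow_right_mono ?_ j (mem_span_pow h𝒜 hr))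
        exact span_le_irrelevantIdeal.trans hI
      obtain ⟨a, ha, b, hb, hab⟩ := Submodule.mem_sup.1 (hk h1)
      have h2 : r • w = b • w := by
        rw [← hab, add_smul, (Ideal.mem_torsionOf_iff w a).1 ha, zero_add]
      -- Since `r • w` is homogeneous of degree `j + n`, only the component of `b` in degree `j`
      -- contributes. This component lies in J𝔠, not merely in J, which is what N ⊆ JN requires.
      have h3 : b • w = (decompose 𝒜 b j : R) • w := by
        classical
        have h4 : M.proj (j + n) (b • w) = b • w := by
          rw [← h2]
          exact proj_same (M.smul_mem hr hn)
        rw [← h4]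
        conv_lhs => rw [← sum_support_decompose 𝒜 b, Finset.sum_smul, map_sum]
        by_cases hj : j ∈ (decompose 𝒜 b).support
        · rw [Finset.sum_eq_single_of_mem j hj, proj_same (M.smul_mem (decompose 𝒜 b j).2 hn)]
          intro l _ hl
          exact proj_ne (M.smul_mem (decompose 𝒜 b l).2 hn) (by omega)
        · rw [Finset.sum_eq_zero]
          · have : decompose 𝒜 b j = 0 := by simpa using hj
            rw [this]
            simp
          · intro l hl
            refine proj_ne (M.smul_mem (decompose 𝒜 b l).2 hn) fun h => hj ?_
            rwa [← show l = j by omega]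
      rw [h2, h3, ← Submodule.mul_smul]
      refine Submodule.smul_mem_smul (decompose_mem_of_mem_extendIdeal hb j fun r hr => ?_)
        (Submodule.mem_span_singleton_self w)
      exact Ideal.subset_span ⟨j, hkj, hr⟩
  have hfg : N.FG := Submodule.FG.smul (IsNoetherian.noetherian 𝔠) (Submodule.fg_span_singleton w)
  -- Nakayama gives `r` congruent to 1 modulo J that kills `N`. As `v` is homogeneous, the degree 0
  -- component of `r` kills it as well, and this component is a unit of the local ring R₀.
  obtain ⟨r, hr1, hr⟩ := Submodule.exists_sub_one_mem_and_smul_eq_zero_of_fg_of_le_smul J N hfg hN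
  have hxk : x ^ k ∈ 𝒜 k := by simpa using SetLike.pow_mem_graded k hx
  refine ⟨k, ?_⟩
  set v := x ^ k • w with hv
  have hvn : v ∈ M.deg (k + n) := M.smul_mem hxk hn
  have hrv : r • v = 0 := hr v (Submodule.smul_mem_smul (Ideal.subset_span ⟨k, le_rfl, hxk⟩)
    (Submodule.mem_span_singleton_self w))
  have h0 : (decompose 𝒜 r 0 : R) • v = 0 := by
    have := lowest_smul_lowest hrv 0 (k + n) (fun i hi => absurd hi (Nat.not_lt_zero i))
      (fun m hm => proj_ne hvn (by omega))
    rwa [proj_same hvn] at this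
  have hu : IsUnit (decompose 𝒜 r 0) := by
    have h1 := decompose_zero_mem_of_mem_extendIdeal hr1
    have h2 : decompose 𝒜 (r - 1) 0 = decompose 𝒜 r 0 - 1 := by
      rw [decompose_sub, decompose_one]
      rfl
    rw [h2] at h1
    by_contra hcon
    refine (IsLocalRing.maximalIdeal.isMaximal (𝒜 0)).ne_top ((Ideal.eq_top_iff_one _).2 ?_)
    have := sub_mem ((IsLocalRing.mem_maximalIdeal _).2 hcon) h1
    rwa [sub_sub_cancel] at this
  obtain ⟨u, hu⟩ := hu.exists_left_inv
  have hu' : (u : R) * (decompose 𝒜 r 0 : R) = 1 := congrArg Subtype.val hu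
  rw [← one_smul R v, ← hu', mul_smul, h0, smul_zero]

theorem exists_pow_smul_of_mem_torsion (h𝒜 : IsStandardGraded 𝒜) {I : Ideal R}
    (hI : irrelevantIdeal 𝒜 ≤ I) {M : GrMod 𝒜} {w : M}
    (hw : w ∈ torsion I (extendIdeal 𝒜 (IsLocalRing.maximalIdeal (𝒜 0))) M) {x : R}
    (hx : x ∈ 𝒜 1) : ∃ k : ℕ, x ^ k • w = 0 := by
  have h : ∀ n, ∃ k : ℕ, x ^ k • M.proj n w = 0 := fun n =>
    exists_pow_smul_of_homogeneous h𝒜 hI (M.proj_mem n w) (isHomogeneous_torsion _ _ M w hw n) hx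
  choose k hk using h
  obtain ⟨s, hs, -⟩ := M.exists_sum_proj w
  refine ⟨s.sup k, ?_⟩
  rw [hs, Finset.smul_sum]
  refine Finset.sum_eq_zero fun n hn => ?_
  rw [← Nat.sub_add_cancel (Finset.le_sup hn : k n ≤ s.sup k), pow_add, mul_smul, hk, smul_zero]

/-- A cohomology class is represented by a cycle in the torsion submodule of a term of an injective
resolution, and a power of `x` kills that cycle. -/
theorem exists_pow_smul_localCohomology (h𝒜 : IsStandardGraded 𝒜) {I : Ideal R}
    (hI : irrelevantIdeal 𝒜 ≤ I) (i : ℕ) (M : GrMod 𝒜) {x : R} (hx : x ∈ 𝒜 1)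
    (y : localCohomology I (extendIdeal 𝒜 (IsLocalRing.maximalIdeal (𝒜 0))) i M) :
    ∃ k : ℕ, x ^ k • y = 0 := by
  let J := extendIdeal 𝒜 (IsLocalRing.maximalIdeal (𝒜 0))
  let Q := InjectiveResolution.of M
  let F := torsionFunctor 𝒜 I J
  let K := (F.mapHomologicalComplex (ComplexShape.up ℕ)).obj Q.cocomplex
  let a := Q.rightDerivedIso F i
  obtain ⟨z, hz⟩ := surjective_of_epi (HomologicalComplex.homologyπ K i) (lin a.hom y)
  let w : torsion I J (Q.cocomplex.X i) := lin (HomologicalComplex.iCycles K i) z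
  obtain ⟨k, hk⟩ := exists_pow_smul_of_mem_torsion h𝒜 hI w.2 hx
  refine ⟨k, ?_⟩
  have h1 : x ^ k • z = 0 := by
    apply injective_of_mono (HomologicalComplex.iCycles K i)
    refine (map_smul _ _ _).trans (Eq.trans ?_ (map_zero _).symm)
    exact Subtype.ext hk
  have h2 : lin a.hom (x ^ k • y) = 0 := by
    refine ((lin a.hom).map_smul (x ^ k) y).trans ?_
    refine (congrArg (x ^ k • ·) hz.symm).trans ?_
    refine ((lin (HomologicalComplex.homologyπ K i)).map_smul (x ^ k) z).symm.trans ?_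
    exact (congrArg _ h1).trans (map_zero _)
  rw [← lin_hom_inv a (x ^ k • y)]
  exact (congrArg _ h2).trans (map_zero _)

end GrMod

/-! ### Truncations and local cohomology of modules bounded above -/

namespace GrMod

variable {R : Type u} [CommRing R] {𝒜 : ℕ → AddSubgroup R}

theorem proj_proj (M : GrMod 𝒜) (m n : ℤ) (x : M) :
    M.proj m (M.proj n x) = if n = m then M.proj n x else 0 := by
  split_ifs with h
  · subst h
    exact proj_same (M.proj_mem n x)
  · exact proj_ne (M.proj_mem n x) h

/-- The largest graded submodule concentrated in degrees at most `d`. -/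
def below (M : GrMod 𝒜) (d : ℤ) : Submodule R M where
  carrier := {x | ∀ r : R, ∀ n > d, M.proj n (r • x) = 0}
  zero_mem' r n _ := by rw [smul_zero, map_zero]
  add_mem' hx hy r n hn := by rw [smul_add, map_add, hx r n hn, hy r n hn, add_zero]
  smul_mem' s x hx r n hn := by rw [← mul_smul]; exact hx _ n hn

/-- This is the universal property of `below`: every map from a module in degrees at most `d`
factors through it. -/
theorem lin_mem_below {M N : GrMod 𝒜} {d : ℤ} (hM : ∀ n > d, M.deg n = ⊥) (f : M ⟶ N) (x : M) :
    lin f x ∈ N.below d := by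
  intro r n hn
  rw [← map_smul, ← lin_proj]
  have : M.proj n (r • x) = 0 := by
    have := M.proj_mem n (r • x)
    rwa [hM n hn, AddSubgroup.mem_bot] at this
  rw [this, map_zero]

theorem quot_deg_eq_bot {M : GrMod 𝒜} {p : Submodule R M} (hp : IsHomogeneous p) {n : ℤ}
    (h : ∀ x ∈ M.deg n, x ∈ p) : (quot p hp).deg n = ⊥ := by
  rw [AddSubgroup.eq_bot_iff_forall]
  rintro _ ⟨x, hx, rfl⟩
  exact (Submodule.Quotient.mk_eq_zero p).2 (h x hx)

variable [GradedRing 𝒜]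

section LongExactSequence

variable [IsNoetherianRing R] (I J : Ideal R) {S : ShortComplex (GrMod 𝒜)}

theorem localCohomology_deg_eq_bot_of_shortExact (hS : S.ShortExact) (i : ℕ) (n : ℤ)
    (h1 : (localCohomology I J i S.X₁).deg n = ⊥) (h3 : (localCohomology I J i S.X₃).deg n = ⊥) :
    (localCohomology I J i S.X₂).deg n = ⊥ := by
  rw [AddSubgroup.eq_bot_iff_forall] at *
  intro y hy
  obtain ⟨w, hw⟩ := (torsionFunctor 𝒜 I J).rightDerived_exact hS i
  obtain ⟨x, hx, rfl⟩ := exists_lin_eq_of_exact hw hy (h3 _ (lin_mem _ hy))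
  rw [h1 x hx]
  exact map_zero _

/-- The kernel of the induced map is the image of the connecting homomorphism, whose source is zero
in degree `n`. -/
theorem eq_zero_of_rightDerived_map_eq_zero_succ (hS : S.ShortExact) (i : ℕ) (n : ℤ)
    (h : (localCohomology I J i S.X₃).deg n = ⊥) (y : localCohomology I J (i + 1) S.X₁)
    (hy : y ∈ (localCohomology I J (i + 1) S.X₁).deg n)
    (hy0 : lin (((torsionFunctor 𝒜 I J).rightDerived (i + 1)).map S.f) y = 0) : y = 0 := by
  rw [AddSubgroup.eq_bot_iff_forall] at h
  obtain ⟨δ, w, hw⟩ := (torsionFunctor 𝒜 I J).exists_rightDerived_connecting hS i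
  obtain ⟨x, hx, rfl⟩ := exists_lin_eq_of_exact hw hy hy0
  rw [h x hx]
  exact map_zero _

theorem eq_zero_of_rightDerived_map_eq_zero_zero (hS : S.ShortExact)
    (y : localCohomology I J 0 S.X₁)
    (hy0 : lin (((torsionFunctor 𝒜 I J).rightDerived 0).map S.f) y = 0) : y = 0 := by
  have := (torsionFunctor 𝒜 I J).mono_rightDerived_zero_map hS
  exact injective_of_mono (((torsionFunctor 𝒜 I J).rightDerived 0).map S.f)
    (hy0.trans (map_zero _).symm)

end LongExactSequence

/-- The ring is graded by ℕ, so scalars never lower degrees. -/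
theorem proj_smul_eq_zero {M : GrMod 𝒜} {d : ℤ} {x : M} (hx : ∀ n ≤ d, M.proj n x = 0) (r : R) :
    ∀ n ≤ d, M.proj n (r • x) = 0 := by
  induction r using DirectSum.Decomposition.inductionOn 𝒜 with
  | zero => simp
  | add r s hr hs =>
    intro n hn
    rw [add_smul, map_add, hr n hn, hs n hn, add_zero]
  | @homogeneous i r =>
    intro n hn
    have := M.proj_smul r.2 x (n - i)
    rw [add_sub_cancel] at this
    rw [this, hx _ (by omega), smul_zero]

/-- The submodule of elements of degree greater than `d`. -/
def above (M : GrMod 𝒜) (d : ℤ) : Submodule R M where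
  carrier := {x | ∀ n ≤ d, M.proj n x = 0}
  zero_mem' n _ := map_zero _
  add_mem' hx hy n hn := by rw [map_add, hx n hn, hy n hn, add_zero]
  smul_mem' r _ hx := proj_smul_eq_zero hx r

theorem isHomogeneous_above (M : GrMod 𝒜) (d : ℤ) : IsHomogeneous (M.above d) := by
  intro x hx n m hm
  rw [proj_proj]
  split_ifs with h
  · subst h
    exact hx _ hm
  · rfl

theorem isHomogeneous_below (M : GrMod 𝒜) (d : ℤ) : IsHomogeneous (M.below d) := by
  intro x hx m r
  induction r using DirectSum.Decomposition.inductionOn 𝒜 with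
  | zero => simp
  | add r s hr hs =>
    intro n hn
    rw [add_smul, map_add, hr n hn, hs n hn, add_zero]
  | @homogeneous i r =>
    intro n hn
    rw [← M.proj_smul r.2, proj_proj]
    split_ifs with h
    · subst h
      exact hx _ _ hn
    · rfl

theorem sub_below_deg_eq_bot (M : GrMod 𝒜) (d : ℤ) {n : ℤ} (hn : d < n) :
    (sub (M.below d) (M.isHomogeneous_below d)).deg n = ⊥ := by
  rw [AddSubgroup.eq_bot_iff_forall]
  intro x hx
  have h1 := x.2 1 n hn
  rw [one_smul] at h1
  exact Subtype.ext ((proj_same (M := M) hx).symm.trans h1)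

theorem quot_above_deg_eq_bot (M : GrMod 𝒜) (d : ℤ) {n : ℤ} (hn : d < n) :
    (quot (M.above d) (M.isHomogeneous_above d)).deg n = ⊥ :=
  quot_deg_eq_bot _ fun _ hx _ hm => proj_ne hx (by omega)

/-- The map induced on the parts of degree at most `d`. -/
def quotAboveMap {X Y : GrMod 𝒜} (f : X ⟶ Y) (d : ℤ) :
    quot (X.above d) (X.isHomogeneous_above d) ⟶ quot (Y.above d) (Y.isHomogeneous_above d) :=
  homMk (M := quot (X.above d) (X.isHomogeneous_above d))
    (N := quot (Y.above d) (Y.isHomogeneous_above d))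
    ((X.above d).mapQ (Y.above d) (lin f) fun x hx n hn => by
      rw [← lin_proj, hx n hn, map_zero])
    (by
      rintro n _ ⟨x, hx, rfl⟩
      exact ⟨lin f x, lin_mem f hx, rfl⟩)

theorem quotAboveMap_injective {X Y : GrMod 𝒜} (f : X ⟶ Y) (hf : Function.Injective (lin f))
    (d : ℤ) : Function.Injective (lin (quotAboveMap f d)) := by
  rw [injective_iff_map_eq_zero]
  intro x hx
  obtain ⟨x, rfl⟩ := (X.above d).mkQ_surjective x
  have h : lin f x ∈ Y.above d := (Submodule.Quotient.mk_eq_zero _).1 hx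
  refine (Submodule.Quotient.mk_eq_zero _).2 fun n hn => hf ?_
  rw [lin_proj, h n hn, map_zero]

/-- A map to a module concentrated in degrees at most `d` factors. -/
def quotAboveDesc {X N : GrMod 𝒜} {d : ℤ} (hN : ∀ n > d, N.deg n = ⊥) (g : X ⟶ N) :
    quot (X.above d) (X.isHomogeneous_above d) ⟶ N :=
  homMk (M := quot (X.above d) (X.isHomogeneous_above d))
    ((X.above d).liftQ (lin g) fun x hx => by
      obtain ⟨s, hs, -⟩ := X.exists_sum_proj x
      rw [LinearMap.mem_ker, hs, map_sum]
      refine Finset.sum_eq_zero fun n _ => ?_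
      rcases le_or_gt n d with hn | hn
      · rw [hx n hn, map_zero]
      · have := lin_mem g (X.proj_mem n x)
        rwa [hN n hn, AddSubgroup.mem_bot] at this)
    (by
      rintro n _ ⟨x, hx, rfl⟩
      exact lin_mem g hx)

/-- A map X → `E.below d` factors through X/X_{>d}, and this truncation preserves monomorphisms.
Extend the factored map to Y/Y_{>d} with values in `E`; its source lives in degrees at most `d`, so
it lands in `E.below d`. -/
theorem injective_below (E : GrMod 𝒜) [Injective E] (d : ℤ) :
    Injective (sub (E.below d) (E.isHomogeneous_below d)) := by
  refine ⟨fun {X Y} g f hf => ?_⟩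
  have hN : ∀ n > d, (sub (E.below d) (E.isHomogeneous_below d)).deg n = ⊥ :=
    fun n hn => sub_below_deg_eq_bot E d hn
  have hm := mono_of_injective _ (quotAboveMap_injective f (injective_of_mono f) d)
  obtain ⟨k, hk⟩ := Injective.factors (quotAboveDesc hN g ≫ subι _ _) (quotAboveMap f d)
  have hmem := lin_mem_below (fun n hn => quot_above_deg_eq_bot Y d hn) k
  refine ⟨quotπ _ (Y.isHomogeneous_above d) ≫
    homMk (M := quot (Y.above d) (Y.isHomogeneous_above d))
      (N := sub (E.below d) (E.isHomogeneous_below d))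
      ((lin k).codRestrict _ hmem) (fun _ _ h => lin_mem k h), hom_ext fun x => Subtype.ext ?_⟩
  exact LinearMap.congr_fun (congrArg lin hk) ((X.above d).mkQ x)

section Bounded

variable [IsNoetherianRing R] (I J : Ideal R)

/-- For injective `E` the zeroth derived functor is the torsion submodule of `E` itself. -/
theorem localCohomology_zero_deg_eq_bot_of_injective (E : GrMod 𝒜) [Injective E] {n : ℤ}
    (hE : E.deg n = ⊥) : (localCohomology I J 0 E).deg n = ⊥ := by
  rw [AddSubgroup.eq_bot_iff_forall] at *
  intro y hy
  let e := asIso ((torsionFunctor 𝒜 I J).toRightDerivedZero.app E)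
  have h1 : lin e.inv y = 0 := Subtype.ext (hE _ (lin_mem e.inv hy))
  exact (lin_inv_hom e y).symm.trans ((congrArg _ h1).trans (map_zero _))

/-- Dimension shifting: `T` embeds in an injective module in degrees at most `d`, and the cokernel
satisfies the same bound. -/
theorem localCohomology_deg_eq_bot_of_concentrated (i : ℕ) :
    ∀ (T : GrMod 𝒜) (d : ℤ), (∀ n > d, T.deg n = ⊥) →
      ∀ n > d, (localCohomology I J i T).deg n = ⊥ := by
  have key : ∀ (T : GrMod 𝒜) (d : ℤ), (∀ n > d, T.deg n = ⊥) →
      ∃ (E : GrMod 𝒜) (_ : Injective E) (f : T ⟶ E),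
        (∀ n > d, E.deg n = ⊥) ∧ Function.Injective (lin f) := by
    intro T d hT
    -- An arbitrary injective module containing `T` may have components above `d`; its part `below
    -- d` is still injective and still contains `T`.
    have hE := injective_below (Injective.under T) d
    refine ⟨_, hE, homMk (M := T)
      (N := sub ((Injective.under T).below d) ((Injective.under T).isHomogeneous_below d))
      ((lin (Injective.ι T)).codRestrict _ (lin_mem_below hT (Injective.ι T)))
      (fun _ _ h => lin_mem (Injective.ι T) h), fun n hn => sub_below_deg_eq_bot _ d hn, ?_⟩
    intro x y hxy
    exact injective_of_mono (Injective.ι T) (congrArg Subtype.val hxy)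
  induction i with
  | zero =>
    intro T d hT n hn
    obtain ⟨E, _, f, hE, hf⟩ := key T d hT
    have h0 := localCohomology_zero_deg_eq_bot_of_injective I J E (hE n hn)
    rw [AddSubgroup.eq_bot_iff_forall] at *
    intro y hy
    exact eq_zero_of_rightDerived_map_eq_zero_zero I J (cokernelSeq_shortExact f hf) y
      (h0 _ (lin_mem _ hy))
  | succ i ih =>
    intro T d hT n hn
    obtain ⟨E, _, f, hE, hf⟩ := key T d hT
    have h1 := ih (quot _ (isHomogeneous_range f)) d (fun m hm => quot_deg_eq_bot _ fun x hx => by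
      rw [hE m hm, AddSubgroup.mem_bot] at hx
      rw [hx]
      exact zero_mem _) n hn
    rw [AddSubgroup.eq_bot_iff_forall]
    intro y hy
    exact eq_zero_of_rightDerived_map_eq_zero_succ I J (cokernelSeq_shortExact f hf) i n h1 y hy
      (eq_zero_of_isZero ((torsionFunctor 𝒜 I J).isZero_rightDerived_obj_injective_succ i E) _)

end Bounded

end GrMod

/-! ### Noetherian induction on finitely generated graded modules -/

namespace GrMod

variable {R : Type u} [CommRing R] {𝒜 : ℕ → AddSubgroup R} [GradedRing 𝒜]

theorem isHomogeneous_span_singleton {M : GrMod 𝒜} {n : ℤ} {m : M} (hm : m ∈ M.deg n) :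
    IsHomogeneous (Submodule.span R {m}) := by
  intro x hx j
  obtain ⟨r, rfl⟩ := Submodule.mem_span_singleton.1 hx
  clear hx
  induction r using DirectSum.Decomposition.inductionOn 𝒜 with
  | zero => simp
  | add r s hr hs =>
    rw [add_smul, map_add]
    exact add_mem hr hs
  | @homogeneous i r =>
    by_cases h : (i : ℤ) + n = j
    · subst h
      rw [proj_same (M.smul_mem r.2 hm)]
      exact Submodule.smul_mem _ _ (Submodule.mem_span_singleton_self m)
    · rw [proj_ne (M.smul_mem r.2 hm) h]
      exact zero_mem _

/-- A nonzero graded module over a Noetherian ring has a nonzero homogeneous element `m` such that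
each homogeneous element of the ring kills `m` or is regular on the submodule generated by `m`. -/
theorem exists_homogeneous_smul_eq_zero_or_regular [IsNoetherianRing R] (M : GrMod 𝒜)
    (hM : ∃ x : M, x ≠ 0) : ∃ (n : ℤ) (m : M), m ∈ M.deg n ∧ m ≠ 0 ∧ ∀ (i : ℕ), ∀ x ∈ 𝒜 i,
      x • m = 0 ∨ ∀ z ∈ Submodule.span R {m}, x • z = 0 → z = 0 := by
  have hne : {I : Ideal R | ∃ (n : ℤ) (m : M), m ∈ M.deg n ∧ m ≠ 0 ∧
      I = Ideal.torsionOf R M m}.Nonempty := by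
    obtain ⟨x, hx⟩ := hM
    obtain ⟨s, hs, -⟩ := M.exists_sum_proj x
    obtain ⟨n, -, hn⟩ := Finset.exists_ne_zero_of_sum_ne_zero (hs ▸ hx)
    exact ⟨_, n, M.proj n x, M.proj_mem n x, hn, rfl⟩
  -- Choose `m` with maximal annihilator among nonzero homogeneous elements.
  obtain ⟨I, ⟨n, m, hm, hm0, rfl⟩, hmax⟩ :=
    set_has_maximal_iff_noetherian.2 (inferInstance : IsNoetherian R R) _ hne
  refine ⟨n, m, hm, hm0, fun i x hx => or_iff_not_imp_left.2 fun hxm z hz hxz => ?_⟩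
  obtain ⟨s, hs, -⟩ := M.exists_sum_proj z
  rw [hs]
  refine Finset.sum_eq_zero fun j _ => by_contra fun hj => ?_
  have hzj : M.proj j z ∈ Submodule.span R {m} := isHomogeneous_span_singleton hm z hz j
  obtain ⟨r, hr⟩ := Submodule.mem_span_singleton.1 hzj
  -- The nonzero component of `z` is a multiple of `m` killed by `x`. By maximality its annihilator
  -- equals that of `m`, so `x` would kill `m`.
  have hle : Ideal.torsionOf R M m ≤ Ideal.torsionOf R M (M.proj j z) := by
    intro a ha
    rw [Ideal.mem_torsionOf_iff] at ha ⊢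
    rw [← hr, smul_comm, ha, smul_zero]
  have hxj : x ∈ Ideal.torsionOf R M (M.proj j z) := by
    rw [Ideal.mem_torsionOf_iff, ← proj_smul M hx, hxz, map_zero]
  refine hmax _ ⟨j, M.proj j z, M.proj_mem j z, hj, rfl⟩ (lt_of_le_of_ne hle fun h => hxm ?_)
  rw [← h] at hxj
  exact (Ideal.mem_torsionOf_iff m x).1 hxj

/-- Noetherian induction for finitely generated graded modules. -/
theorem induction_on_cyclic [IsNoetherianRing R] {P : GrMod 𝒜 → Prop}
    (zero : ∀ M : GrMod 𝒜, (∀ x : M, x = 0) → P M)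
    (ext : ∀ S : ShortComplex (GrMod 𝒜), S.ShortExact → P S.X₁ → P S.X₃ → P S.X₂)
    (cyclic : ∀ (M : GrMod 𝒜) (n : ℤ) (m : M) (hm : m ∈ M.deg n), (∀ (i : ℕ), ∀ x ∈ 𝒜 i,
      x • m = 0 ∨ ∀ z ∈ Submodule.span R {m}, x • z = 0 → z = 0) →
      P (sub (Submodule.span R {m}) (isHomogeneous_span_singleton hm)))
    (M : GrMod 𝒜) [Module.Finite R M] : P M := by
  have : IsNoetherian R M := isNoetherian_of_isNoetherianRing_of_finite R M
  -- The claim is proved for all graded quotients of `M`, by ascending induction on the kernel; `M`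
  -- itself is the quotient with kernel zero.
  suffices h : ∀ (N : Submodule R M) (Q : GrMod 𝒜) (f : M ⟶ Q), Function.Surjective (lin f) →
      LinearMap.ker (lin f) = N → P Q from
    h _ M (𝟙 M) Function.surjective_id rfl
  intro N
  induction N using WellFoundedGT.induction with
  | _ N ih =>
    rintro Q f hf rfl
    by_cases hQ : ∃ x : Q, x ≠ 0
    · obtain ⟨n, m, hm, hm0, h⟩ := exists_homogeneous_smul_eq_zero_or_regular Q hQ
      let ι := subι (Submodule.span R {m}) (isHomogeneous_span_singleton hm)
      have hι : Function.Injective (lin ι) := Subtype.val_injective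
      refine ext _ (cokernelSeq_shortExact ι hι) (cyclic Q n m hm h) ?_
      refine ih _ ?_ _ (f ≫ quotπ _ (isHomogeneous_range ι))
        ((Submodule.mkQ_surjective _).comp hf) rfl
      -- The kernel grows strictly: a preimage of the nonzero element `m` belongs to the new kernel
      -- and not to the old one.
      refine lt_of_le_of_ne ?_ fun h => hm0 ?_
      · intro x hx
        change Submodule.mkQ _ (lin f x) = 0
        rw [LinearMap.mem_ker.1 hx, map_zero]
      · obtain ⟨x, rfl⟩ := hf m
        have hx : x ∈ LinearMap.ker (lin (f ≫ quotπ _ (isHomogeneous_range ι))) :=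
          (Submodule.Quotient.mk_eq_zero _).2
            ⟨(⟨lin f x, Submodule.mem_span_singleton_self _⟩ :
              Submodule.span R {lin f x}), rfl⟩
        exact h.ge hx
    · push Not at hQ
      exact zero Q hQ

/-- Each component R_i with i > 0 lies in the ideal generated by R₁ and so kills `m`; only R₀m
survives, in degree `n`. -/
theorem sub_span_singleton_deg_eq_bot (h𝒜 : IsStandardGraded 𝒜) {M : GrMod 𝒜} {n : ℤ} {m : M}
    (hm : m ∈ M.deg n) (h : ∀ x ∈ 𝒜 1, x • m = 0) {j : ℤ} (hj : n < j) :
    (sub (Submodule.span R {m}) (isHomogeneous_span_singleton hm)).deg j = ⊥ := by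
  rw [AddSubgroup.eq_bot_iff_forall]
  rintro ⟨z, hz⟩ hzj
  refine Subtype.ext ?_
  have hle : Ideal.span (𝒜 1 : Set R) ≤ Ideal.torsionOf R M m :=
    Ideal.span_le.2 fun x hx => (Ideal.mem_torsionOf_iff m x).2 (h x hx)
  have key : ∀ r : R, M.proj j (r • m) = 0 := by
    intro r
    induction r using DirectSum.Decomposition.inductionOn 𝒜 with
    | zero => simp
    | add r s hr hs => rw [add_smul, map_add, hr, hs, add_zero]
    | @homogeneous i r =>
      by_cases hi : i = 0
      · subst hi
        exact proj_ne (M.smul_mem r.2 hm) (by push_cast; omega)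
      · have h1 := hle (Ideal.pow_le_self hi (mem_span_pow h𝒜 r.2))
        rw [(Ideal.mem_torsionOf_iff m _).1 h1, map_zero]
  obtain ⟨r, rfl⟩ := Submodule.mem_span_singleton.1 hz
  exact (proj_same (M := M) hzj).symm.trans (key r)

/-! ### Vanishing in large degrees -/

section Vanishing

variable [IsNoetherianRing R] {I : Ideal R} {i : ℕ}

/-- Multiplication by `x` raises the degree, so one bound `n₀` serves for every power. -/
theorem eq_zero_of_pow_smul_eq_zero {J : Ideal R} {M : GrMod 𝒜} {x : R} (hx : x ∈ 𝒜 1) {n₀ : ℤ}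
    (h : ∀ n ≥ n₀, ∀ y ∈ (localCohomology I J i M).deg n, x • y = 0 → y = 0) (k : ℕ) :
    ∀ n ≥ n₀, ∀ y ∈ (localCohomology I J i M).deg n, x ^ k • y = 0 → y = 0 := by
  induction k with
  | zero =>
    intro n _ y _ hxy
    rwa [pow_zero, one_smul] at hxy
  | succ k ih =>
    intro n hn y hy hxy
    refine h n hn y hy (ih (1 + n) (by omega) _ ?_ ?_)
    · exact_mod_cast (localCohomology I J i M).smul_mem hx hy
    · rwa [← mul_smul, ← pow_succ]

variable [IsLocalRing (𝒜 0)]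

/-- This is the part of the argument common to i = 0 and to the induction step: injectivity in large
degrees of the map induced by a regular `x` suffices, since `x` is also locally nilpotent. -/
theorem eventually_localCohomology_deg_eq_bot_of_map (h𝒜 : IsStandardGraded 𝒜)
    (hI : irrelevantIdeal 𝒜 ≤ I)
    (h : ∀ (N : GrMod 𝒜) [Module.Finite R N] (x : R) (hx : x ∈ 𝒜 1),
      Function.Injective (lin ((shiftSMul hx).app N)) → ∃ n₀ : ℤ, ∀ n ≥ n₀,
      ∀ y ∈ (localCohomology I (extendIdeal 𝒜 (IsLocalRing.maximalIdeal (𝒜 0))) i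
        ((shiftFunctor 𝒜 (1 : ℕ)).obj N)).deg n,
      lin (((torsionFunctor 𝒜 I (extendIdeal 𝒜 (IsLocalRing.maximalIdeal (𝒜 0)))).rightDerived
        i).map ((shiftSMul hx).app N)) y = 0 → y = 0)
    (M : GrMod 𝒜) [Module.Finite R M] : ∀ᶠ n : ℤ in Filter.atTop,
      (localCohomology I (extendIdeal 𝒜 (IsLocalRing.maximalIdeal (𝒜 0))) i M).deg n = ⊥ := by
  induction M using induction_on_cyclic with
  | zero M hM =>
    filter_upwards [Filter.eventually_gt_atTop 0] with n hn
    exact localCohomology_deg_eq_bot_of_concentrated _ _ i M 0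
      (fun n _ => (AddSubgroup.eq_bot_iff_forall _).2 fun x _ => hM x) n hn
  | ext S hS h1 h3 =>
    filter_upwards [h1, h3] with n h1 h3
    exact localCohomology_deg_eq_bot_of_shortExact _ _ hS i n h1 h3
  | cyclic M n m hm hreg =>
    by_cases hx : ∀ x ∈ 𝒜 1, x • m = 0
    · filter_upwards [Filter.eventually_gt_atTop n] with j hj
      exact localCohomology_deg_eq_bot_of_concentrated _ _ i _ n
        (fun l hl => sub_span_singleton_deg_eq_bot h𝒜 hm hx hl) j hj
    · push Not at hx
      obtain ⟨x, hx, hxm⟩ := hx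
      have hinj := (hreg 1 x hx).resolve_left hxm
      set N := sub (Submodule.span R {m}) (isHomogeneous_span_singleton hm)
      have : Module.Finite R N :=
        inferInstanceAs (Module.Finite R (Submodule.span R {m}))
      obtain ⟨n₀, hn₀⟩ := h N x hx ((injective_iff_map_eq_zero _).2 fun z hz =>
        Subtype.ext (hinj z.1 z.2 (congrArg Subtype.val hz)))
      filter_upwards [Filter.eventually_ge_atTop n₀] with n hn
      rw [AddSubgroup.eq_bot_iff_forall]
      intro y hy
      -- The exponent depends on `y`, but the degree bound does not.
      obtain ⟨k, hk⟩ := exists_pow_smul_localCohomology h𝒜 hI i N hx y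
      refine eq_zero_of_pow_smul_eq_zero hx (fun n hn y hy hxy => ?_) k n hn y hy hk
      exact eq_zero_of_smul_eq_zero I _ hx i n N (hn₀ _ (by push_cast; omega)) y hy hxy

/-- The local cohomology modules of a finitely generated graded module with respect to a pair of
ideals `(I, 𝔪₀R)` with `R₊ ⊆ I` vanish in all large degrees. -/
theorem eventually_localCohomology_deg_eq_bot (h𝒜 : IsStandardGraded 𝒜)
    (hI : irrelevantIdeal 𝒜 ≤ I) (i : ℕ) (M : GrMod 𝒜) [Module.Finite R M] :
    ∀ᶠ n : ℤ in Filter.atTop,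
      (localCohomology I (extendIdeal 𝒜 (IsLocalRing.maximalIdeal (𝒜 0))) i M).deg n = ⊥ := by
  induction i generalizing M with
  | zero =>
    refine eventually_localCohomology_deg_eq_bot_of_map h𝒜 hI (fun N _ x hx hinj => ?_) M
    exact ⟨0, fun n _ y _ hy => eq_zero_of_rightDerived_map_eq_zero_zero _ _
      (cokernelSeq_shortExact _ hinj) y hy⟩
  | succ i ih =>
    refine eventually_localCohomology_deg_eq_bot_of_map h𝒜 hI (fun N _ x hx hinj => ?_) M
    have : Module.Finite R (quot _ (isHomogeneous_range ((shiftSMul hx).app N))) :=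
      inferInstanceAs (Module.Finite R (N ⧸ LinearMap.range (lin ((shiftSMul hx).app N))))
    obtain ⟨n₀, hn₀⟩ := Filter.eventually_atTop.1
      (ih (quot _ (isHomogeneous_range ((shiftSMul hx).app N))))
    exact ⟨n₀, fun n hn y hy hy0 => eq_zero_of_rightDerived_map_eq_zero_succ _ _
      (cokernelSeq_shortExact _ hinj) i n (hn₀ n hn) y hy hy0⟩

end Vanishing

end GrMod

end

theorem theorem3p2 {R : Type u} [CommRing R] [IsNoetherianRing R]
    (𝒜 : ℕ → AddSubgroup R) [GradedRing 𝒜] (h𝒜 : IsStandardGraded 𝒜)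
    [IsLocalRing (𝒜 0)] (𝔟₀ : Ideal (𝒜 0)) (i : ℕ)
    (h : ∀ M : GrMod 𝒜, Module.Finite R M → ∀ᶠ n : ℤ in Filter.atTop,
      (⨅ k : ℕ, IsLocalRing.maximalIdeal (𝒜 0) ^ k •
        (⊤ : Submodule (𝒜 0)
          ((GrMod.localCohomology (extendIdeal 𝒜 𝔟₀ ⊔ irrelevantIdeal 𝒜)
            (extendIdeal 𝒜 (IsLocalRing.maximalIdeal (𝒜 0))) i M).deg n))) = ⊥) :
    ∀ M : GrMod 𝒜, Module.Finite R M → ∀ᶠ n : ℤ in Filter.atTop,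
      (GrMod.localCohomology (extendIdeal 𝒜 𝔟₀ ⊔ irrelevantIdeal 𝒜)
        (extendIdeal 𝒜 (IsLocalRing.maximalIdeal (𝒜 0))) i M).deg n = ⊥ :=
  -- The ideal 𝔟 enters only through R₊ ⊆ 𝔟.
  fun M _ => GrMod.eventually_localCohomology_deg_eq_bot h𝒜 le_sup_right i M
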